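/- Model. Let $n,d\ge 1$, $\sigma>0$, let $\pi^\star$ be a permutation of $[n]$ with permutation matrix $P^\star$, and let $Q^\star\in\mathcal O(d)$. Let $X=(x_1,\dots,x_n)$ and $Z=(z_1,\dots,z_n)$ be independent $d\times n$ matrices with i.i.d. $\mathcal N(0,1)$ entries, and set $Y=Q^\star X(P^\star)^\top+\sigma Z$, i.e. $y_i=Q^\star x_{\pi^\star(i)}+\sigma z_i$. A maximum-likelihood estimator $(\hat P,\hat Q)$ (with $\hat P$ the permutation matrix of $\hat\pi$) is any minimizer of $\frac1n\|XP^\top-Q^\top Y\|_F^2$ over permutation matrices $P$ and $Q\in\mathcal O(d)$. Write $\mathrm{ov}(\pi,\pi')=\frac1n\sum_{i=1}^n\mathbf 1_{\{\pi(i)=\pi'(i)\}}$, $c^2(\pi,\pi')=\frac1n\sum_{i=1}^n\|x_{\pi(i)}-x_{\pi'(i)}\|^2$ and $\ell^2(Q,Q')=\|Q-Q'\|_F^2$. Theorem. (i) There exist universal constants $c_1,c_2,c_3>0$ such that, whenever $d\ge 2\log n$, with probability $1-o(1)$ as $n\to\infty$ (the $o(1)$ depending only on $n$, and not on $d,\sigma,\pi^\star,Q^\star$),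 all maximum-likelihood estimators satisfy both $$\mathrm{ov}(\pi^\star,\hat\pi)\ \ge\ 1-\max\Big(60\sigma^2,\ c_1\frac dn,\ c_2\frac{\log n}{d\log d}\Big)$$ and $$\frac{\ell^2(Q^\star,\hat Q)}{2d}\ \le\ c_1\frac dn+c_2\sigma^2+c_3\max\Big(\frac{d\log n}{n},\ \sqrt{\frac{\log n}{n}}\Big).$$ (ii) Consequently, if $d=d_n$ and $\sigma=\sigma_n>0$ satisfy $\log n=o(d)$, $d\log d=o(n)$ and $\sigma\to0$ as $n\to\infty$, then for any $\pi^\star_n,Q^\star_n$ and every $\varepsilon>0$, with probability tending to $1$, all maximum-likelihood estimators satisfy $\mathrm{ov}(\pi^\star,\hat\pi)\ge 1-\varepsilon$, $c^2(\hat\pi,\pi^\star)\le\varepsilon d$ and $\ell^2(\hat Q,Q^\star)\le\varepsilon d$. -/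

import Mathlib

open Filter Topology MeasureTheory ProbabilityTheory Asymptotics
open scoped ENNReal Matrix

namespace ProcrustesWasserstein

noncomputable section

/-- The product (Borel) σ-algebra on real matrices. -/
instance instMeasurableSpaceMatrix {d n : ℕ} : MeasurableSpace (Matrix (Fin d) (Fin n) ℝ) :=
  inferInstanceAs (MeasurableSpace (Fin d → Fin n → ℝ))

/-- The law of a `d × n` matrix whose columns are i.i.d. standard Gaussian vectors of `ℝ^d`,
i.e. whose entries are i.i.d. `N(0,1)`. -/
def gaussianMatrix (d n : ℕ) : Measure (Matrix (Fin d) (Fin n) ℝ) :=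
  Measure.pi fun _ : Fin d => Measure.pi fun _ : Fin n => gaussianReal 0 1

/-- The joint law of the pair `(X, Z)`: independent `d × n` standard Gaussian matrices. -/
def gaussianPair (d n : ℕ) :
    Measure (Matrix (Fin d) (Fin n) ℝ × Matrix (Fin d) (Fin n) ℝ) :=
  (gaussianMatrix d n).prod (gaussianMatrix d n)

/-- The permutation matrix `P` of `π`, with `P i j = 1` iff `j = π i`, so that the `i`-th column
of `X * Pᵀ` is `x_{π(i)}`. -/
abbrev permMat {n : ℕ} (π : Equiv.Perm (Fin n)) : Matrix (Fin n) (Fin n) ℝ :=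
  π.permMatrix ℝ

/-- The observation `Y = Q⋆ X (P⋆)ᵀ + σ Z`. -/
def observation {d n : ℕ} (σ : ℝ) (πs : Equiv.Perm (Fin n))
    (Qs : Matrix.orthogonalGroup (Fin d) ℝ) (X Z : Matrix (Fin d) (Fin n) ℝ) :
    Matrix (Fin d) (Fin n) ℝ :=
  (Qs : Matrix (Fin d) (Fin d) ℝ) * X * (permMat πs)ᵀ + σ • Z

section Frobenius

attribute [local instance] Matrix.frobeniusNormedAddCommGroup

/-- The objective `(1/n) ‖X Pᵀ - Qᵀ Y‖_F²`. -/
def loss {d n : ℕ} (X Y : Matrix (Fin d) (Fin n) ℝ) (π : Equiv.Perm (Fin n))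
    (Q : Matrix.orthogonalGroup (Fin d) ℝ) : ℝ :=
  (1 / (n : ℝ)) * ‖X * (permMat π)ᵀ - (Q : Matrix (Fin d) (Fin d) ℝ)ᵀ * Y‖ ^ 2

/-- The squared Frobenius distance `ℓ²(Q, Q') = ‖Q - Q'‖_F²`. -/
def ell2 {d : ℕ} (Q Q' : Matrix.orthogonalGroup (Fin d) ℝ) : ℝ :=
  ‖(Q : Matrix (Fin d) (Fin d) ℝ) - (Q' : Matrix (Fin d) (Fin d) ℝ)‖ ^ 2

end Frobenius

/-- `(π, Q)` is a maximum-likelihood estimate from the data `(X, Y)`: a minimizer of the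
objective over all permutations and all orthogonal matrices. -/
def IsMLE {d n : ℕ} (X Y : Matrix (Fin d) (Fin n) ℝ) (π : Equiv.Perm (Fin n))
    (Q : Matrix.orthogonalGroup (Fin d) ℝ) : Prop :=
  ∀ (π' : Equiv.Perm (Fin n)) (Q' : Matrix.orthogonalGroup (Fin d) ℝ),
    loss X Y π Q ≤ loss X Y π' Q'

/-- The overlap `ov(π, π') = (1/n) ∑ᵢ 1{π(i) = π'(i)}`. -/
def overlap {n : ℕ} (π π' : Equiv.Perm (Fin n)) : ℝ :=
  (1 / (n : ℝ)) * ∑ i : Fin n, if π i = π' i then 1 else 0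

/-- The transport cost `c²(π, π') = (1/n) ∑ᵢ ‖x_{π(i)} - x_{π'(i)}‖²` (Euclidean norm), where
`x_j` is the `j`-th column of `X`. -/
def transportCost {d n : ℕ} (X : Matrix (Fin d) (Fin n) ℝ) (π π' : Equiv.Perm (Fin n)) : ℝ :=
  (1 / (n : ℝ)) * ∑ i : Fin n, ‖WithLp.toLp 2 (X.col (π i)) - WithLp.toLp 2 (X.col (π' i))‖ ^ 2

/-- The event that some maximum-likelihood estimate `(π, Q)` computed from `X` and
`Y = Q⋆ X (P⋆)ᵀ + σ Z` violates the property `good X π Q`. -/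
def mleFails {d n : ℕ} (σ : ℝ) (πs : Equiv.Perm (Fin n))
    (Qs : Matrix.orthogonalGroup (Fin d) ℝ)
    (good : Matrix (Fin d) (Fin n) ℝ → Equiv.Perm (Fin n) →
      Matrix.orthogonalGroup (Fin d) ℝ → Prop) :
    Set (Matrix (Fin d) (Fin n) ℝ × Matrix (Fin d) (Fin n) ℝ) :=
  {ω | ∃ (π : Equiv.Perm (Fin n)) (Q : Matrix.orthogonalGroup (Fin d) ℝ),
    IsMLE ω.1 (observation σ πs Qs ω.1 ω.2) π Q ∧ ¬ good ω.1 π Q}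

end

end ProcrustesWasserstein

/-!
The argument is deterministic once a few properties of the Gaussian data are known, and these
properties (`goodEvent`) involve neither `σ` nor the planted pair, so all bounds are uniform in them.

*Basic inequality.* A minimizer `(π, Q)` fits the data at least as well as the truth `(πs, Qs)`.
With `O = Qs⁻¹ Q`, `ρ = π ∘ πs⁻¹` and `w i` the columns of `X`, the triangle inequality gives
`∑ i, ‖w i - O w (ρ i)‖² ≤ 4 σ² ‖Z‖²` (`IsMLE.sum_sub_mulVec_le`), and `‖Z‖²` is at most
`1.05 n d`.

*Overlap.* If `ρ` moves `k` points, a third of them form a set `S` with `ρ S` disjoint from `S`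
(`exists_disjoint_image_subset`). For a fixed `O` the vectors `w i - O w (ρ i)`, `i ∈ S`, are then
independent with law `N(0, 2 I)`, so the probability that the sum of their squared norms is below
an eighth of its mean `2 |S| d` is at most `exp (-3 |S| d / 5)`. This survives a union bound over
an `ε`-net of the orthogonal group with `exp (O(d²))` points, which costs little since
`|S| ≥ 400 d / 3`, over the injections of `S`, at most `n ^ |S| ≤ exp (|S| d / 2)` in number as
`2 log n ≤ d`, and over the sets `S`, where `|S| d log d ≥ n log n` makes the cost
`exp (O(|S| log d))` (`measureReal_exists_sum_sub_mulVec_le`). Comparison with the basic inequality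
bounds `k` (`IsTypical.le_overlap`).

*Orthogonal matrix.* With high probability the Gram matrices of all subfamilies of at least `n / 2`
columns are bounded below by a multiple of `n` (`measureReal_exists_sum_dotProduct_sq_lt`). If
`ρ` fixes half of the points, the basic inequality restricted to these points reads
`n ‖1 - O‖² ≲ σ² n d`, a bound by `σ² d` alone (`IsTypical.ell2_le_of_overlap`). If it does not,
the overlap bound shows that `σ²` or `d / n` is bounded below, and then the claim on `Q` follows
from `‖Qs - Q‖² ≤ 4 d`.

The limit statement follows by letting the explicit bounds tend to `0`; the transport cost is
controlled by the overlap and the uniform bound `‖w j‖² ≤ 16 d`.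
-/

namespace ProcrustesWasserstein

/-! ### Gaussian integrals of quadratic exponentials -/

/-- The standard Gaussian law on `ℝ^d`. -/
noncomputable abbrev gaussianVec (d : ℕ) : Measure (Fin d → ℝ) := Measure.pi fun _ => gaussianReal 0 1

/-- The law of `n` i.i.d. standard Gaussian vectors of `ℝ^d`, the columns of a Gaussian matrix. -/
noncomputable abbrev gaussianCols (d n : ℕ) : Measure (Fin n → Fin d → ℝ) := Measure.pi fun _ => gaussianVec d

lemma integral_exp_neg_mul_sq_sub_gaussianReal {l : ℝ} (hl : 0 < 1 + 2 * l) (v : ℝ) :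
    ∫ x, Real.exp (-l * (x - v) ^ 2) ∂(gaussianReal 0 1) =
      (√(1 + 2 * l))⁻¹ * Real.exp (-(l / (1 + 2 * l)) * v ^ 2) := by
  rw [integral_gaussianReal_eq_integral_smul one_ne_zero]
  have h1 : ∀ x : ℝ, gaussianPDFReal 0 1 x • Real.exp (-l * (x - v) ^ 2) =
      (√(2 * Real.pi))⁻¹ * Real.exp (-(l / (1 + 2 * l)) * v ^ 2) *
        Real.exp (-((1 + 2 * l) / 2) * (x - 2 * l * v / (1 + 2 * l)) ^ 2) := by
    intro x
    simp only [gaussianPDFReal, NNReal.coe_one, mul_one, sub_zero, smul_eq_mul]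
    rw [mul_assoc, mul_assoc, ← Real.exp_add, ← Real.exp_add]
    congr 2
    field_simp
    ring
  simp_rw [h1]
  rw [integral_const_mul,
    integral_sub_right_eq_self (fun x : ℝ => Real.exp (-((1 + 2 * l) / 2) * x ^ 2)),
    integral_gaussian]
  have h2 : √(Real.pi / ((1 + 2 * l) / 2)) = √(2 * Real.pi) * (√(1 + 2 * l))⁻¹ := by
    rw [← Real.sqrt_inv, ← Real.sqrt_mul (by positivity)]
    congr 1
    field_simp
  have h3 : √(2 * Real.pi) ≠ 0 := by positivity
  rw [h2]
  field_simp

lemma exp_neg_mul_dotProduct_self {d : ℕ} (l : ℝ) (x : Fin d → ℝ) :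
    Real.exp (-l * (x ⬝ᵥ x)) = ∏ a, Real.exp (-l * x a ^ 2) := by
  rw [← Real.exp_sum, dotProduct, Finset.mul_sum]
  simp only [sq]

lemma integral_exp_neg_mul_dotProduct_sub {d : ℕ} {l : ℝ} (hl : 0 < 1 + 2 * l) (v : Fin d → ℝ) :
    ∫ x, Real.exp (-l * ((x - v) ⬝ᵥ (x - v))) ∂(gaussianVec d) =
      (√(1 + 2 * l))⁻¹ ^ d * Real.exp (-(l / (1 + 2 * l)) * (v ⬝ᵥ v)) := by
  simp_rw [exp_neg_mul_dotProduct_self, Pi.sub_apply]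
  rw [integral_fintype_prod_eq_prod (fun a (x : ℝ) => Real.exp (-l * (x - v a) ^ 2))]
  simp_rw [integral_exp_neg_mul_sq_sub_gaussianReal hl]
  simp [Finset.prod_mul_distrib]

lemma integral_exp_neg_mul_dotProduct_self {d : ℕ} {l : ℝ} (hl : 0 < 1 + 2 * l) :
    ∫ x, Real.exp (-l * (x ⬝ᵥ x)) ∂(gaussianVec d) = (√(1 + 2 * l))⁻¹ ^ d := by
  simpa using integral_exp_neg_mul_dotProduct_sub hl (0 : Fin d → ℝ)

/-- A unit-norm linear functional of a standard Gaussian vector is a standard Gaussian variable. -/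
lemma map_dotProduct_gaussianVec {d : ℕ} {u : Fin d → ℝ} (hu : u ⬝ᵥ u = 1) :
    (gaussianVec d).map (fun x => u ⬝ᵥ x) = gaussianReal 0 1 := by
  set L : StrongDual ℝ (EuclideanSpace ℝ (Fin d)) := innerSL ℝ (WithLp.toLp 2 u) with hL
  have h := IsGaussian.map_eq_gaussianReal (μ := stdGaussian (EuclideanSpace ℝ (Fin d))) L
  rw [variance_dual_stdGaussian, integral_strongDual_stdGaussian, ← map_pi_eq_stdGaussian,
    Measure.map_map (by fun_prop) (by fun_prop)] at h
  have h1 : ‖L‖ ^ 2 = 1 := by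
    rw [hL, innerSL_apply_norm, EuclideanSpace.norm_sq_eq]
    simpa [dotProduct, sq] using hu
  have h2 : (⇑L ∘ WithLp.toLp 2) = fun x : Fin d → ℝ => u ⬝ᵥ x := by
    ext x
    simp [hL, PiLp.inner_apply, dotProduct, mul_comm]
  rw [h1, h2] at h
  simpa using h

lemma integral_exp_neg_mul_dotProduct_sq {d : ℕ} {l : ℝ} (hl : 0 < 1 + 2 * l) {u : Fin d → ℝ}
    (hu : u ⬝ᵥ u = 1) :
    ∫ x, Real.exp (-l * (u ⬝ᵥ x) ^ 2) ∂(gaussianVec d) = (√(1 + 2 * l))⁻¹ := by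
  have h := integral_map (μ := gaussianVec d) (φ := fun x => u ⬝ᵥ x)
    (f := fun y => Real.exp (-l * y ^ 2)) (by fun_prop)
    (Continuous.aestronglyMeasurable (by fun_prop))
  rw [← h, map_dotProduct_gaussianVec hu]
  simpa using integral_exp_neg_mul_sq_sub_gaussianReal hl 0

lemma integral_exp_neg_mul_sum_dotProduct_sq {d n : ℕ} {l : ℝ} (hl : 0 < 1 + 2 * l)
    {u : Fin d → ℝ} (hu : u ⬝ᵥ u = 1) (F : Finset (Fin n)) :
    ∫ w, Real.exp (-l * ∑ i ∈ F, (u ⬝ᵥ w i) ^ 2) ∂(gaussianCols d n) =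
      (√(1 + 2 * l))⁻¹ ^ F.card := by
  have h : ∀ w : Fin n → Fin d → ℝ, Real.exp (-l * ∑ i ∈ F, (u ⬝ᵥ w i) ^ 2) =
      ∏ i, if i ∈ F then Real.exp (-l * (u ⬝ᵥ w i) ^ 2) else 1 := by
    intro w
    rw [Finset.prod_ite_mem, Finset.univ_inter, ← Real.exp_sum, Finset.mul_sum]
  simp_rw [h]
  rw [integral_fintype_prod_eq_prod
    (fun i (x : Fin d → ℝ) => if i ∈ F then Real.exp (-l * (u ⬝ᵥ x) ^ 2) else 1)]
  have h2 : ∀ i, ∫ x, (if i ∈ F then Real.exp (-l * (u ⬝ᵥ x) ^ 2) else 1) ∂(gaussianVec d) =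
      if i ∈ F then (√(1 + 2 * l))⁻¹ else 1 := by
    intro i
    split_ifs
    · exact integral_exp_neg_mul_dotProduct_sq hl hu
    · simp
  simp_rw [h2]
  simp [Finset.prod_ite_mem]

lemma integral_exp_neg_mul_sum_dotProduct_self {d n : ℕ} {l : ℝ} (hl : 0 < 1 + 2 * l) :
    ∫ w, Real.exp (-l * ∑ i, w i ⬝ᵥ w i) ∂(gaussianCols d n) = (√(1 + 2 * l))⁻¹ ^ (d * n) := by
  simp_rw [Finset.mul_sum, Real.exp_sum]
  rw [integral_fintype_prod_eq_prod (fun _ (x : Fin d → ℝ) => Real.exp (-l * (x ⬝ᵥ x)))]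
  simp_rw [integral_exp_neg_mul_dotProduct_self hl]
  simp [pow_mul]

lemma integral_exp_neg_mul_dotProduct_self_apply {d n : ℕ} {l : ℝ} (hl : 0 < 1 + 2 * l)
    (j : Fin n) :
    ∫ w, Real.exp (-l * (w j ⬝ᵥ w j)) ∂(gaussianCols d n) = (√(1 + 2 * l))⁻¹ ^ d := by
  rw [← integral_exp_neg_mul_dotProduct_self hl]
  exact integral_comp_eval (μ := fun _ : Fin n => gaussianVec d) (i := j)
    (f := fun x => Real.exp (-l * (x ⬝ᵥ x))) (Continuous.aestronglyMeasurable (by fun_prop))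

lemma dotProduct_mulVec_orthogonal {d : ℕ} (Q : Matrix.orthogonalGroup (Fin d) ℝ)
    (v : Fin d → ℝ) :
    ((Q : Matrix (Fin d) (Fin d) ℝ) *ᵥ v) ⬝ᵥ ((Q : Matrix (Fin d) (Fin d) ℝ) *ᵥ v) = v ⬝ᵥ v := by
  have h : (Q : Matrix (Fin d) (Fin d) ℝ)ᵀ * (Q : Matrix (Fin d) (Fin d) ℝ) = 1 :=
    (Matrix.mem_orthogonalGroup_iff' (Fin d) ℝ).1 Q.2
  rw [Matrix.dotProduct_mulVec, Matrix.vecMul_mulVec, h, Matrix.vecMul_one]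

lemma dotProduct_self_nonneg_real {d : ℕ} (v : Fin d → ℝ) : 0 ≤ v ⬝ᵥ v :=
  Finset.sum_nonneg fun _ _ => mul_self_nonneg _

/-- If `f` maps `S` injectively to its complement, the vectors `w i - Q w (f i)`, `i ∈ S`, are
independent with law `N(0, 2 I)`. The Laplace transform of the sum of their squared norms follows
by integrating over the vectors indexed by `S` first, and over the other ones afterwards. -/
lemma integral_exp_neg_mul_sum_sub_mulVec {d n : ℕ} {l : ℝ} (hl : 0 ≤ l) (S : Finset (Fin n))
    (f : S → Fin n) (hf : Function.Injective f) (hfS : ∀ i, f i ∉ S)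
    (Q : Matrix.orthogonalGroup (Fin d) ℝ) :
    ∫ w, Real.exp (-l * ∑ i : S, (w i - (Q : Matrix (Fin d) (Fin d) ℝ) *ᵥ w (f i)) ⬝ᵥ
        (w i - (Q : Matrix (Fin d) (Fin d) ℝ) *ᵥ w (f i))) ∂(gaussianCols d n) =
      (√(1 + 4 * l))⁻¹ ^ (d * S.card) := by
  set q : Matrix (Fin d) (Fin d) ℝ := (Q : Matrix (Fin d) (Fin d) ℝ) with hq
  set μ : ℝ := l / (1 + 2 * l) with hμ
  have hl1 : 0 < 1 + 2 * l := by positivity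
  have hμ0 : 0 ≤ μ := by positivity
  have hmp := measurePreserving_piEquivPiSubtypeProd
    (fun _ : Fin n => gaussianVec d) (fun i => i ∈ S)
  let f' : S → {i // ¬ i ∈ S} := fun i => ⟨f i, hfS i⟩
  have hf' : Function.Injective f' := fun i j hij => hf (congrArg Subtype.val hij)
  let G : ({i // i ∈ S} → Fin d → ℝ) × ({i // ¬ i ∈ S} → Fin d → ℝ) → ℝ := fun p =>
    Real.exp (-l * ∑ i : S, (p.1 i - q *ᵥ p.2 (f' i)) ⬝ᵥ (p.1 i - q *ᵥ p.2 (f' i)))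
  have hG : ∫ w : Fin n → Fin d → ℝ, G (fun i => w i, fun i => w i) ∂(gaussianCols d n) =
      ∫ p, G p ∂((Measure.pi fun i : {i // i ∈ S} => gaussianVec d).prod
        (Measure.pi fun i : {i // ¬ i ∈ S} => gaussianVec d)) := by
    convert hmp.integral_comp' G <;> rfl
  have hGc : Continuous G := by
    unfold G
    fun_prop
  have hGi : Integrable G ((Measure.pi fun i : {i // i ∈ S} => gaussianVec d).prod
      (Measure.pi fun i : {i // ¬ i ∈ S} => gaussianVec d)) := by
    refine Integrable.of_bound hGc.aestronglyMeasurable 1 (ae_of_all _ fun p => ?_)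
    rw [Real.norm_eq_abs, abs_of_pos (Real.exp_pos _), Real.exp_le_one_iff]
    have := Finset.sum_nonneg (s := Finset.univ) fun (i : S) _ =>
      dotProduct_self_nonneg_real (p.1 i - q *ᵥ p.2 (f' i))
    nlinarith
  refine hG.trans ?_
  rw [integral_prod_symm _ hGi]
  have inner : ∀ y : {i // ¬ i ∈ S} → Fin d → ℝ,
      ∫ x, G (x, y) ∂(Measure.pi fun i : {i // i ∈ S} => gaussianVec d) =
      ∏ j : {i // ¬ i ∈ S}, if j ∈ Finset.univ.image f' then
        (√(1 + 2 * l))⁻¹ ^ d * Real.exp (-μ * (y j ⬝ᵥ y j)) else 1 := by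
    intro y
    simp only [G, Finset.mul_sum, Real.exp_sum]
    rw [integral_fintype_prod_eq_prod (fun (i : {i // i ∈ S}) (x : Fin d → ℝ) =>
      Real.exp (-l * ((x - q *ᵥ y (f' i)) ⬝ᵥ (x - q *ᵥ y (f' i)))))]
    simp_rw [integral_exp_neg_mul_dotProduct_sub hl1]
    rw [Finset.prod_ite_mem, Finset.univ_inter, Finset.prod_image fun i _ j _ h => hf' h]
    refine Finset.prod_congr rfl fun i _ => ?_
    rw [hq, dotProduct_mulVec_orthogonal]
  simp_rw [inner]
  rw [integral_fintype_prod_eq_prod (fun (j : {i // ¬ i ∈ S}) (x : Fin d → ℝ) =>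
    if j ∈ Finset.univ.image f' then
        (√(1 + 2 * l))⁻¹ ^ d * Real.exp (-μ * (x ⬝ᵥ x)) else 1)]
  have outer : ∀ j : {i // ¬ i ∈ S}, ∫ x, (if j ∈ Finset.univ.image f' then
        (√(1 + 2 * l))⁻¹ ^ d * Real.exp (-μ * (x ⬝ᵥ x)) else 1) ∂(gaussianVec d) =
      if j ∈ Finset.univ.image f' then (√(1 + 4 * l))⁻¹ ^ d else 1 := by
    intro j
    split_ifs
    · rw [integral_const_mul, integral_exp_neg_mul_dotProduct_self (by positivity), ← mul_pow,
        ← mul_inv, ← Real.sqrt_mul hl1.le]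
      congr 4
      rw [hμ]
      field_simp
      ring
    · simp
  simp_rw [outer]
  rw [Finset.prod_ite_mem, Finset.univ_inter, Finset.prod_const,
    Finset.card_image_of_injective _ hf', Finset.card_univ, Fintype.card_coe, pow_mul]

/-! ### Finite nets -/

lemma card_le_of_pairwise_lt_norm_sub {E : Type*} [NormedAddCommGroup E] [NormedSpace ℝ E]
    [FiniteDimensional ℝ E] {ε : ℝ} (hε : 0 < ε) (s : Finset E) (hs : ∀ c ∈ s, ‖c‖ ≤ 1)
    (h : ∀ c ∈ s, ∀ c' ∈ s, c ≠ c' → ε < ‖c - c'‖) :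
    (s.card : ℝ) ≤ (1 + 2 / ε) ^ Module.finrank ℝ E := by
  borelize E
  let μ : Measure E := Measure.addHaar
  have δpos : 0 < ε / 2 := by positivity
  have ρpos : 0 < 1 + ε / 2 := by positivity
  have D : Set.Pairwise (s : Set E) (Function.onFun Disjoint fun c => Metric.ball c (ε / 2)) := by
    rintro c hc c' hc' hne
    apply Metric.ball_disjoint_ball
    rw [dist_eq_norm]
    linarith [h c hc c' hc' hne]
  have hsub : (⋃ c ∈ s, Metric.ball c (ε / 2)) ⊆ Metric.ball (0 : E) (1 + ε / 2) := by
    refine Set.iUnion₂_subset fun x hx => Metric.ball_subset_ball' ?_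
    rw [dist_zero_right]
    linarith [hs x hx]
  have I : (s.card : ℝ≥0∞) * ENNReal.ofReal ((ε / 2) ^ Module.finrank ℝ E) *
      μ (Metric.ball 0 1) ≤
      ENNReal.ofReal ((1 + ε / 2) ^ Module.finrank ℝ E) * μ (Metric.ball 0 1) := by
    calc _ = μ (⋃ c ∈ s, Metric.ball c (ε / 2)) := by
          rw [measure_biUnion_finset D fun c _ => measurableSet_ball]
          simp only [μ.addHaar_ball_of_pos _ δpos]
          simp only [Finset.sum_const, nsmul_eq_mul, mul_assoc]
      _ ≤ μ (Metric.ball (0 : E) (1 + ε / 2)) := measure_mono hsub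
      _ = _ := by simp only [μ.addHaar_ball_of_pos _ ρpos]
  have J := (ENNReal.mul_le_mul_iff_left (Metric.measure_ball_pos _ _ zero_lt_one).ne'
    measure_ball_lt_top.ne).1 I
  have K := ENNReal.toReal_le_of_le_ofReal (pow_nonneg ρpos.le _) J
  rw [ENNReal.toReal_mul, ENNReal.toReal_natCast, ENNReal.toReal_ofReal (by positivity),
    ← le_div_iff₀ (by positivity), ← div_pow] at K
  refine K.trans_eq (congrArg (· ^ _) ?_)
  field_simp
  ring

/-- Every subset of the unit ball of a finite-dimensional normed space has an internal `ε`-net of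
the size given by the volume comparison of disjoint balls. -/
lemma exists_finset_net {E : Type*} [NormedAddCommGroup E] [NormedSpace ℝ E]
    [FiniteDimensional ℝ E] {ε : ℝ} (hε : 0 < ε) (A : Set E) (hA : ∀ a ∈ A, ‖a‖ ≤ 1) :
    ∃ N : Finset E, ↑N ⊆ A ∧ (N.card : ℝ) ≤ (1 + 2 / ε) ^ Module.finrank ℝ E ∧
      ∀ a ∈ A, ∃ b ∈ N, ‖a - b‖ ≤ ε := by
  classical
  -- A separated subset of maximal size is a net; sizes are bounded by volume comparison.
  let P : ℕ → Prop := fun k => ∃ s : Finset E, ↑s ⊆ A ∧ s.card = k ∧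
    ∀ c ∈ s, ∀ c' ∈ s, c ≠ c' → ε < ‖c - c'‖
  have hbd : ∀ s : Finset E, ↑s ⊆ A → (∀ c ∈ s, ∀ c' ∈ s, c ≠ c' → ε < ‖c - c'‖) →
      (s.card : ℝ) ≤ (1 + 2 / ε) ^ Module.finrank ℝ E := fun s hs h =>
    card_le_of_pairwise_lt_norm_sub hε s (fun c hc => hA c (hs hc)) h
  obtain ⟨N, hNA, hNc, hNsep⟩ : P (Nat.findGreatest P ⌊(1 + 2 / ε) ^ Module.finrank ℝ E⌋₊) :=
    Nat.findGreatest_spec (Nat.zero_le _) ⟨∅, by simp⟩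
  refine ⟨N, hNA, hbd N hNA hNsep, fun a ha => ?_⟩
  by_contra! hcon
  have haN : a ∉ N := fun h => by
    have := hcon a h
    simp at this
    linarith
  have hsub : ↑(insert a N) ⊆ A := by
    rw [Finset.coe_insert]
    exact Set.insert_subset ha hNA
  have hsep : ∀ c ∈ insert a N, ∀ c' ∈ insert a N, c ≠ c' → ε < ‖c - c'‖ := by
    intro c hc c' hc' hne
    rcases Finset.mem_insert.1 hc with rfl | hcN <;>
      rcases Finset.mem_insert.1 hc' with rfl | hcN'
    · exact absurd rfl hne
    · exact hcon c' hcN'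
    · rw [norm_sub_rev]
      exact hcon c hcN
    · exact hNsep c hcN c' hcN' hne
  have hle := Nat.le_findGreatest (P := P) (Nat.le_floor (hbd _ hsub hsep))
    ⟨_, hsub, rfl, hsep⟩
  rw [Finset.card_insert_of_notMem haN, hNc] at hle
  omega

/-- An `ε`-net of the orthogonal group for the operator norm. -/
lemma exists_finset_net_orthogonalGroup (d : ℕ) {ε : ℝ} (hε : 0 < ε) :
    ∃ N : Finset (Matrix.orthogonalGroup (Fin d) ℝ), (N.card : ℝ) ≤ (1 + 2 / ε) ^ (d ^ 2) ∧
      ∀ Q : Matrix.orthogonalGroup (Fin d) ℝ, ∃ Q' ∈ N, ∀ v : Fin d → ℝ,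
        (((Q : Matrix (Fin d) (Fin d) ℝ) - (Q' : Matrix (Fin d) (Fin d) ℝ)) *ᵥ v) ⬝ᵥ
          (((Q : Matrix (Fin d) (Fin d) ℝ) - (Q' : Matrix (Fin d) (Fin d) ℝ)) *ᵥ v) ≤
        ε ^ 2 * (v ⬝ᵥ v) := by
  classical
  have hsq : ∀ v : EuclideanSpace ℝ (Fin d), ‖v‖ ^ 2 = v.ofLp ⬝ᵥ v.ofLp := fun v => by
    rw [EuclideanSpace.norm_sq_eq]
    simp [dotProduct, sq]
  let Φ : Matrix.orthogonalGroup (Fin d) ℝ → (EuclideanSpace ℝ (Fin d) →L[ℝ]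
      EuclideanSpace ℝ (Fin d)) := fun Q =>
    Matrix.toEuclideanCLM (n := Fin d) (𝕜 := ℝ) (Q : Matrix (Fin d) (Fin d) ℝ)
  have hΦ : Function.Injective Φ := fun Q Q' h =>
    Subtype.ext (Matrix.toEuclideanCLM.injective h)
  have hΦ1 : ∀ a ∈ Set.range Φ, ‖a‖ ≤ 1 := by
    rintro _ ⟨Q, rfl⟩
    refine ContinuousLinearMap.opNorm_le_bound _ zero_le_one fun v => ?_
    rw [one_mul]
    refine le_of_sq_le_sq ?_ (norm_nonneg _)
    rw [hsq, hsq, Matrix.ofLp_toEuclideanCLM, dotProduct_mulVec_orthogonal]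
  obtain ⟨N, hN, hNc, hNnet⟩ := exists_finset_net hε (Set.range Φ) hΦ1
  have hfin : Module.finrank ℝ (EuclideanSpace ℝ (Fin d) →L[ℝ] EuclideanSpace ℝ (Fin d)) =
      d ^ 2 := by
    rw [← (Matrix.toEuclideanCLM (n := Fin d) (𝕜 := ℝ)).toAlgEquiv.toLinearEquiv.finrank_eq]
    simp [sq, Module.finrank_matrix]
  refine ⟨N.preimage Φ hΦ.injOn, ?_, fun Q => ?_⟩
  · rw [hfin] at hNc
    refine le_trans ?_ hNc
    exact_mod_cast Finset.card_le_card_of_injOn Φ (fun Q hQ => by simpa using hQ) hΦ.injOn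
  · obtain ⟨b, hb, hab⟩ := hNnet (Φ Q) ⟨Q, rfl⟩
    obtain ⟨Q', rfl⟩ := hN hb
    refine ⟨Q', by simpa using hb, fun v => ?_⟩
    have h1 := (Φ Q - Φ Q').le_of_opNorm_le hab (WithLp.toLp 2 v)
    have h2 : (Φ Q - Φ Q') = Matrix.toEuclideanCLM (n := Fin d) (𝕜 := ℝ)
        ((Q : Matrix (Fin d) (Fin d) ℝ) - (Q' : Matrix (Fin d) (Fin d) ℝ)) :=
      (map_sub _ _ _).symm
    have h3 := pow_le_pow_left₀ (norm_nonneg _) h1 2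
    rwa [mul_pow, hsq, hsq, h2, Matrix.ofLp_toEuclideanCLM] at h3

/-- An `ε`-net of the unit sphere of `ℝ^d`. -/
lemma exists_finset_net_sphere (d : ℕ) {ε : ℝ} (hε : 0 < ε) :
    ∃ N : Finset (EuclideanSpace ℝ (Fin d)), (N.card : ℝ) ≤ (1 + 2 / ε) ^ d ∧
      (∀ u ∈ N, ‖u‖ = 1) ∧ ∀ v : EuclideanSpace ℝ (Fin d), ‖v‖ = 1 → ∃ u ∈ N, ‖v - u‖ ≤ ε := by
  obtain ⟨N, hN, hc, hnet⟩ := exists_finset_net hε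
    (Metric.sphere (0 : EuclideanSpace ℝ (Fin d)) 1) (fun a ha => by simp_all)
  refine ⟨N, by simpa using hc, fun u hu => by simpa using hN hu, fun v hv => hnet v (by simpa)⟩

/-! ### Exponential tail bounds for fixed configurations -/

/-- Chernoff bound for the lower tail. Integrability is automatic since the integral is not `0`. -/
lemma measureReal_le_of_integral_exp {Ω : Type*} [MeasurableSpace Ω] {μ : Measure Ω}
    [IsProbabilityMeasure μ] {f : Ω → ℝ} {l I : ℝ} (hl : 0 ≤ l) (hI : 0 < I)
    (h : ∫ ω, Real.exp (-l * f ω) ∂μ = I) (a : ℝ) :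
    μ.real {ω | f ω ≤ a} ≤ Real.exp (l * a) * I := by
  have hi : Integrable (fun ω => Real.exp (-l * f ω)) μ :=
    Integrable.of_integral_ne_zero (by rw [h]; exact hI.ne')
  have := measure_le_le_exp_mul_mgf a (neg_nonpos.2 hl) hi
  rwa [mgf, h, neg_neg] at this

/-- Chernoff bound for the upper tail. -/
lemma measureReal_ge_of_integral_exp {Ω : Type*} [MeasurableSpace Ω] {μ : Measure Ω}
    [IsProbabilityMeasure μ] {f : Ω → ℝ} {l I : ℝ} (hl : l ≤ 0) (hI : 0 < I)
    (h : ∫ ω, Real.exp (-l * f ω) ∂μ = I) (a : ℝ) :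
    μ.real {ω | a ≤ f ω} ≤ Real.exp (l * a) * I := by
  have hi : Integrable (fun ω => Real.exp (-l * f ω)) μ :=
    Integrable.of_integral_ne_zero (by rw [h]; exact hI.ne')
  have := measure_ge_le_exp_mul_mgf a (neg_nonneg.2 hl) hi
  rwa [mgf, h, neg_neg] at this

lemma inv_sqrt_pow_eq_exp {b : ℝ} (hb : 0 < b) (k : ℕ) :
    (√b)⁻¹ ^ k = Real.exp (-(k * (Real.log b / 2))) := by
  rw [Real.exp_neg, mul_comm, ← Real.log_sqrt hb.le, mul_comm, Real.exp_nat_mul,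
    Real.exp_log (Real.sqrt_pos.2 hb), inv_pow]

/-- With `a ≤ s d / 4`, an eighth of the mean, the Chernoff bound optimized at `l = 7 / 4` has rate
`(3 log 2 - 7 / 8) / 2 > 3 / 5` per coordinate. It matters that this rate exceeds `1 / 2`. -/
lemma measureReal_sum_sub_mulVec_le {d n : ℕ} (S : Finset (Fin n))
    (f : S → Fin n) (hf : Function.Injective f) (hfS : ∀ i, f i ∉ S)
    (Q : Matrix.orthogonalGroup (Fin d) ℝ) :
    (gaussianCols d n).real {w | ∑ i : S, (w i - (Q : Matrix (Fin d) (Fin d) ℝ) *ᵥ w (f i)) ⬝ᵥ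
        (w i - (Q : Matrix (Fin d) (Fin d) ℝ) *ᵥ w (f i)) ≤ S.card * d / 4} ≤
      Real.exp (-(3 / 5 * (S.card * d))) := by
  refine (measureReal_le_of_integral_exp (l := 7 / 4) (by norm_num) (by positivity)
    (integral_exp_neg_mul_sum_sub_mulVec (by norm_num) S f hf hfS Q) _).trans ?_
  rw [inv_sqrt_pow_eq_exp (by norm_num), ← Real.exp_add, Real.exp_le_exp]
  have h8 : Real.log (1 + 4 * (7 / 4)) = 3 * Real.log 2 := by
    rw [show (1 + 4 * (7 / 4) : ℝ) = 2 ^ 3 by norm_num, Real.log_pow]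
    norm_num
  rw [h8]
  have := Real.log_two_gt_d9
  have hsd : (0 : ℝ) ≤ S.card * d := by positivity
  push_cast
  nlinarith

/-- Lower tail of a chi-squared variable far below its mean, with a rate large enough to pay for
a union over all subsets `F` with at least `n / 2` elements. -/
lemma measureReal_sum_dotProduct_sq_le {d n : ℕ} {u : Fin d → ℝ} (hu : u ⬝ᵥ u = 1)
    (F : Finset (Fin n)) (hF : n ≤ 2 * F.card) :
    (gaussianCols d n).real {w | ∑ i ∈ F, (u ⬝ᵥ w i) ^ 2 ≤ n / 2 ^ 12} ≤
      Real.exp (-n) := by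
  refine (measureReal_le_of_integral_exp (l := 2 ^ 12 / 2) (by norm_num) (by positivity)
    (integral_exp_neg_mul_sum_dotProduct_sq (by norm_num) hu F) _).trans ?_
  rw [inv_sqrt_pow_eq_exp (by norm_num), ← Real.exp_add, Real.exp_le_exp]
  have h8 : 12 * Real.log 2 ≤ Real.log (1 + 2 * (2 ^ 12 / 2)) := by
    rw [← Real.log_rpow (by norm_num)]
    exact Real.log_le_log (by positivity) (by norm_num)
  have := Real.log_two_gt_d9
  have hF' : (n : ℝ) ≤ 2 * F.card := by exact_mod_cast hF
  nlinarith

lemma measureReal_le_sum_dotProduct_sq {d n : ℕ} {u : Fin d → ℝ} (hu : u ⬝ᵥ u = 1) :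
    (gaussianCols d n).real {w | (16 * n : ℝ) ≤ ∑ i, (u ⬝ᵥ w i) ^ 2} ≤ Real.exp (-(3 * n)) := by
  refine (measureReal_ge_of_integral_exp (l := -(1 / 4)) (by norm_num) (by positivity)
    (integral_exp_neg_mul_sum_dotProduct_sq (by norm_num) hu Finset.univ) _).trans ?_
  rw [inv_sqrt_pow_eq_exp (by norm_num), ← Real.exp_add, Real.exp_le_exp,
    show (1 + 2 * -(1 / 4) : ℝ) = 2⁻¹ by norm_num, Real.log_inv]
  have := Real.log_two_lt_d9
  have : (0 : ℝ) ≤ n := by positivity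
  simp
  nlinarith

lemma measureReal_le_dotProduct_self {d n : ℕ} (j : Fin n) :
    (gaussianCols d n).real {w | (16 * d : ℝ) ≤ w j ⬝ᵥ w j} ≤ Real.exp (-(3 * d)) := by
  refine (measureReal_ge_of_integral_exp (l := -(1 / 4)) (by norm_num) (by positivity)
    (integral_exp_neg_mul_dotProduct_self_apply (by norm_num) j) _).trans ?_
  rw [inv_sqrt_pow_eq_exp (by norm_num), ← Real.exp_add, Real.exp_le_exp,
    show (1 + 2 * -(1 / 4) : ℝ) = 2⁻¹ by norm_num, Real.log_inv]
  have := Real.log_two_lt_d9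
  have : (0 : ℝ) ≤ d := by positivity
  nlinarith

lemma measureReal_le_sum_dotProduct_self {d n : ℕ} :
    (gaussianCols d n).real {w | (21 / 20 * (n * d) : ℝ) ≤ ∑ j, w j ⬝ᵥ w j} ≤
      Real.exp (-(n * d / 10000)) := by
  refine (measureReal_ge_of_integral_exp (l := -(1 / 50)) (by norm_num) (by positivity)
    (integral_exp_neg_mul_sum_dotProduct_self (by norm_num)) _).trans ?_
  rw [inv_sqrt_pow_eq_exp (by norm_num), ← Real.exp_add, Real.exp_le_exp]
  have h := Real.one_sub_inv_le_log_of_pos (x := 1 + 2 * -(1 / 50)) (by norm_num)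
  norm_num at h ⊢
  have : (0 : ℝ) ≤ n * d := by positivity
  nlinarith

/-! ### Uniform bounds for Gaussian vectors -/

lemma pow_eq_exp_mul_log {b : ℝ} (hb : 0 < b) (k : ℕ) : b ^ k = Real.exp (k * Real.log b) := by
  rw [Real.exp_nat_mul, Real.exp_log hb]

lemma measureReal_exists_le_dotProduct_self (d n : ℕ) :
    (gaussianCols d n).real {w | ∃ j, (16 * d : ℝ) ≤ w j ⬝ᵥ w j} ≤ n * Real.exp (-(3 * d)) := by
  rw [show {w : Fin n → Fin d → ℝ | ∃ j, (16 * d : ℝ) ≤ w j ⬝ᵥ w j} =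
    ⋃ j, {w | (16 * d : ℝ) ≤ w j ⬝ᵥ w j} by ext; simp]
  refine (measureReal_iUnion_fintype_le _).trans
    ((Finset.sum_le_sum fun j _ => measureReal_le_dotProduct_self j).trans ?_)
  simp

/-- The analysis operator `v ↦ (⟨w i, v⟩)_{i ∈ F}`. -/
noncomputable def analysisOp {d n : ℕ} (w : Fin n → Fin d → ℝ) (F : Finset (Fin n)) :
    EuclideanSpace ℝ (Fin d) →L[ℝ] EuclideanSpace ℝ F :=
  LinearMap.toContinuousLinearMap (Matrix.toEuclideanLin (Matrix.of fun i : F => w i))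

lemma norm_analysisOp_sq {d n : ℕ} (w : Fin n → Fin d → ℝ) (F : Finset (Fin n))
    (v : EuclideanSpace ℝ (Fin d)) :
    ‖analysisOp w F v‖ ^ 2 = ∑ i ∈ F, (v.ofLp ⬝ᵥ w i) ^ 2 := by
  rw [EuclideanSpace.norm_sq_eq, ← Finset.sum_coe_sort F]
  refine Finset.sum_congr rfl fun i _ => ?_
  rw [Real.norm_eq_abs, sq_abs, dotProduct_comm]
  rfl

/-- Two-sided control on a `2⁻¹⁰`-net of the sphere extends to the whole space: the upper bound on
the net bounds the operator norm, which in turn controls the error of the lower bound. -/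
lemma le_sum_dotProduct_sq_of_net {d n : ℕ} {w : Fin n → Fin d → ℝ}
    {N : Finset (EuclideanSpace ℝ (Fin d))}
    (hnet : ∀ v : EuclideanSpace ℝ (Fin d), ‖v‖ = 1 → ∃ u ∈ N, ‖v - u‖ ≤ 1 / 2 ^ 10)
    (hup : ∀ u ∈ N, ∑ i, (u.ofLp ⬝ᵥ w i) ^ 2 ≤ 16 * n) {F : Finset (Fin n)}
    (hlow : ∀ u ∈ N, n / 2 ^ 12 ≤ ∑ i ∈ F, (u.ofLp ⬝ᵥ w i) ^ 2) (v : Fin d → ℝ) :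
    n / 2 ^ 14 * (v ⬝ᵥ v) ≤ ∑ i ∈ F, (v ⬝ᵥ w i) ^ 2 := by
  set T := analysisOp w Finset.univ with hT
  set TF := analysisOp w F with hTF
  have hn : √(n : ℝ) ^ 2 = n := Real.sq_sqrt (Nat.cast_nonneg n)
  have hn0 := Real.sqrt_nonneg (n : ℝ)
  have hTu : ∀ u ∈ N, ‖T u‖ ≤ 4 * √n := fun u hu => by
    refine le_of_sq_le_sq ?_ (by positivity)
    rw [hT, norm_analysisOp_sq, mul_pow, hn]
    linarith [hup u hu]
  have hTFu : ∀ u ∈ N, √n / 2 ^ 6 ≤ ‖TF u‖ := fun u hu => by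
    refine le_of_sq_le_sq ?_ (norm_nonneg _)
    rw [hTF, norm_analysisOp_sq, div_pow, hn]
    refine le_trans (le_of_eq ?_) (hlow u hu)
    norm_num
  have hop : ‖T‖ ≤ 4 * √n + 1 / 2 ^ 10 * ‖T‖ := by
    refine T.opNorm_le_of_unit_norm (by positivity) fun v hv => ?_
    obtain ⟨u, hu, huv⟩ := hnet v hv
    calc ‖T v‖ = ‖T u + T (v - u)‖ := by rw [← map_add, add_sub_cancel]
      _ ≤ ‖T u‖ + ‖T‖ * ‖v - u‖ := (norm_add_le _ _).trans (by gcongr; exact T.le_opNorm _)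
      _ ≤ 4 * √n + 1 / 2 ^ 10 * ‖T‖ := by
        have := hTu u hu
        have : ‖T‖ * ‖v - u‖ ≤ ‖T‖ * (1 / 2 ^ 10) := by gcongr
        linarith
  have hunit : ∀ v : EuclideanSpace ℝ (Fin d), ‖v‖ = 1 → √n / 2 ^ 7 ≤ ‖TF v‖ := by
    intro v hv
    obtain ⟨u, hu, huv⟩ := hnet v hv
    have h1 : ‖TF (v - u)‖ ≤ ‖T (v - u)‖ := by
      refine le_of_sq_le_sq ?_ (norm_nonneg _)
      rw [hT, hTF, norm_analysisOp_sq, norm_analysisOp_sq]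
      exact Finset.sum_le_sum_of_subset_of_nonneg (Finset.subset_univ _) fun _ _ _ => sq_nonneg _
    have h2 : ‖T (v - u)‖ ≤ ‖T‖ * (1 / 2 ^ 10) := (T.le_opNorm _).trans (by gcongr)
    have h3 : ‖TF u‖ ≤ ‖TF v‖ + ‖TF (v - u)‖ := by
      have : TF u = TF v - TF (v - u) := by rw [← map_sub, sub_sub_cancel]
      rw [this]
      exact norm_sub_le _ _
    have h4 := hTFu u hu
    linarith
  by_cases hv : v = 0
  · simp [hv]
  set v' : EuclideanSpace ℝ (Fin d) := WithLp.toLp 2 v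
  have hv' : 0 < ‖v'‖ := by
    rw [norm_pos_iff]
    simpa [v'] using hv
  have hsq : ‖v'‖ ^ 2 = v ⬝ᵥ v := by
    rw [EuclideanSpace.norm_sq_eq]
    simp [v', dotProduct, sq]
  have h5 := hunit (‖v'‖⁻¹ • v') (by rw [norm_smul, norm_inv, norm_norm, inv_mul_cancel₀ hv'.ne'])
  rw [map_smul, norm_smul, norm_inv, norm_norm, inv_mul_eq_div, le_div_iff₀ hv'] at h5
  have h6 := pow_le_pow_left₀ (by positivity) h5 2
  rw [mul_pow, div_pow, hn, hTF, norm_analysisOp_sq, hsq] at h6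
  refine le_trans (le_of_eq ?_) h6
  norm_num

/-- With high probability the Gram matrices `∑_{i ∈ F} w i (w i)ᵀ` of all subfamilies with at least
half of the vectors are bounded below by a multiple of `n`. -/
lemma measureReal_exists_sum_dotProduct_sq_lt {d n : ℕ} (hd : 400 * d ≤ n) :
    (gaussianCols d n).real {w | ∃ (F : Finset (Fin n)) (v : Fin d → ℝ), n ≤ 2 * F.card ∧
      ∑ i ∈ F, (v ⬝ᵥ w i) ^ 2 < n / 2 ^ 14 * (v ⬝ᵥ v)} ≤ 2 * Real.exp (-(n / 5)) := by
  classical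
  obtain ⟨N, hNc, hN1, hN⟩ := exists_finset_net_sphere d (ε := 1 / 2 ^ 10) (by norm_num)
  set 𝓕 : Finset (Finset (Fin n)) := Finset.univ.filter fun F => n ≤ 2 * F.card
  set μ := gaussianCols d n
  have hu1 : ∀ u ∈ N, u.ofLp ⬝ᵥ u.ofLp = 1 := fun u hu => by
    have h1 := EuclideanSpace.norm_sq_eq u
    rw [hN1 u hu] at h1
    simpa [dotProduct, sq] using h1.symm
  have hsub : {w : Fin n → Fin d → ℝ | ∃ (F : Finset (Fin n)) (v : Fin d → ℝ), n ≤ 2 * F.card ∧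
      ∑ i ∈ F, (v ⬝ᵥ w i) ^ 2 < n / 2 ^ 14 * (v ⬝ᵥ v)} ⊆
      (⋃ u ∈ N, {w | (16 * n : ℝ) ≤ ∑ i, (u.ofLp ⬝ᵥ w i) ^ 2}) ∪
      ⋃ u ∈ N, ⋃ F ∈ 𝓕, {w | ∑ i ∈ F, (u.ofLp ⬝ᵥ w i) ^ 2 ≤ n / 2 ^ 12} := by
    rintro w ⟨F, v, hF, hlt⟩
    by_contra hcon
    simp only [Set.mem_union, Set.mem_iUnion, Set.mem_ofPred_eq, not_or, not_exists, not_le] at hcon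
    refine absurd hlt (not_lt.2 (le_sum_dotProduct_sq_of_net hN
      (fun u hu => (hcon.1 u hu).le) (fun u hu => (hcon.2 u hu F ?_).le) v))
    simpa [𝓕] using hF
  have hcard : (𝓕.card : ℝ) ≤ Real.exp (n * Real.log 2) := by
    rw [← pow_eq_exp_mul_log (by norm_num)]
    have : 𝓕.card ≤ 2 ^ n := (Finset.card_filter_le _ _).trans (by simp)
    exact_mod_cast this
  have hNc' : (N.card : ℝ) ≤ Real.exp (n / 40) := by
    refine hNc.trans ?_
    have h2 : ((1 : ℝ) + 2 / (1 / 2 ^ 10)) ^ d ≤ (2 ^ 12) ^ d := by gcongr; norm_num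
    refine h2.trans ?_
    have h3 : ((2 : ℝ) ^ 12) ^ d = Real.exp (d * (12 * Real.log 2)) := by
      rw [pow_eq_exp_mul_log (by norm_num), Real.log_pow]
      norm_num
    rw [h3, Real.exp_le_exp]
    have hd' : (400 * d : ℝ) ≤ n := by exact_mod_cast hd
    have := Real.log_two_lt_d9
    have : (0 : ℝ) ≤ d := by positivity
    nlinarith
  have hn : (0 : ℝ) ≤ n := by positivity
  calc _ ≤ μ.real _ := measureReal_mono hsub
    _ ≤ _ := measureReal_union_le _ _
    _ ≤ N.card * Real.exp (-(3 * n)) + N.card * (𝓕.card * Real.exp (-n)) := by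
      refine add_le_add ?_ ?_
      · refine (measureReal_biUnion_finset_le _ _).trans ?_
        rw [← nsmul_eq_mul]
        exact Finset.sum_le_card_nsmul _ _ _ fun u hu => measureReal_le_sum_dotProduct_sq (hu1 u hu)
      · refine (measureReal_biUnion_finset_le _ _).trans ?_
        rw [← nsmul_eq_mul, ← nsmul_eq_mul]
        refine Finset.sum_le_card_nsmul _ _ _ fun u hu => ?_
        refine (measureReal_biUnion_finset_le _ _).trans ?_
        refine Finset.sum_le_card_nsmul _ _ _ fun F hF => ?_
        exact measureReal_sum_dotProduct_sq_le (hu1 u hu) F (Finset.mem_filter.1 hF).2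
    _ ≤ Real.exp (n / 40) * Real.exp (-(3 * n)) +
        Real.exp (n / 40) * (Real.exp (n * Real.log 2) * Real.exp (-n)) := by gcongr
    _ ≤ Real.exp (-(n / 5)) + Real.exp (-(n / 5)) := by
      rw [← Real.exp_add, ← Real.exp_add, ← Real.exp_add]
      have := Real.log_two_lt_d9
      gcongr <;> nlinarith
    _ = 2 * Real.exp (-(n / 5)) := by ring

/-- Passing from an orthogonal matrix to a nearby one in a sum of squared distances. -/
lemma sum_sub_mulVec_le_of_near {d n : ℕ} {w : Fin n → Fin d → ℝ}
    (hw : ∀ j, w j ⬝ᵥ w j ≤ 16 * d) {S : Finset (Fin n)} (f : S → Fin n)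
    {q q' : Matrix (Fin d) (Fin d) ℝ}
    (hq : ∀ v, ((q - q') *ᵥ v) ⬝ᵥ ((q - q') *ᵥ v) ≤ (1 / 100) ^ 2 * (v ⬝ᵥ v))
    (h : ∑ i : S, (w i - q *ᵥ w (f i)) ⬝ᵥ (w i - q *ᵥ w (f i)) ≤ 21 / 100 * (S.card * d)) :
    ∑ i : S, (w i - q' *ᵥ w (f i)) ⬝ᵥ (w i - q' *ᵥ w (f i)) ≤ S.card * d / 4 := by
  -- The budget is `(11 / 10) * (21 / 100) + 11 * 16 / 100 ^ 2 < 1 / 4`.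
  have key : ∀ a b : Fin d → ℝ, (a + b) ⬝ᵥ (a + b) ≤ 11 / 10 * (a ⬝ᵥ a) + 11 * (b ⬝ᵥ b) := by
    intro a b
    simp only [dotProduct, Finset.mul_sum, ← Finset.sum_add_distrib, Pi.add_apply]
    refine Finset.sum_le_sum fun k _ => ?_
    nlinarith [sq_nonneg (a k - 10 * b k)]
  have hterm : ∀ i : S, (w i - q' *ᵥ w (f i)) ⬝ᵥ (w i - q' *ᵥ w (f i)) ≤
      11 / 10 * ((w i - q *ᵥ w (f i)) ⬝ᵥ (w i - q *ᵥ w (f i))) +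
        11 * ((1 / 100) ^ 2 * (16 * d)) := by
    intro i
    have h1 : w i - q' *ᵥ w (f i) = (w i - q *ᵥ w (f i)) + (q - q') *ᵥ w (f i) := by
      rw [Matrix.sub_mulVec]
      abel
    rw [h1]
    refine (key _ _).trans ?_
    have := hq (w (f i))
    have := hw (f i)
    linarith
  refine (Finset.sum_le_sum fun i _ => hterm i).trans ?_
  rw [Finset.sum_add_distrib, ← Finset.mul_sum, Finset.sum_const, Finset.card_univ,
    Fintype.card_coe, nsmul_eq_mul]
  have : (0 : ℝ) ≤ S.card * d := by positivity
  nlinarith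

/-- The numerical heart of the union bound over `s`-element sets, injections and the net. The
factor `n ^ s ≤ exp (s d / 2)` for the injections eats most of the rate `3 / 5`, so the number of
sets must be bounded by `n ^ s / s ! ≤ exp (s + 2 s log d)` rather than by `n ^ s`. -/
lemma choose_mul_pow_mul_exp_le {d n s : ℕ} (hd1 : 1 ≤ d) (hn : 3 ≤ n)
    (hd : 1 + 2 * Real.log d ≤ d / 40)
    (hdn : 2 * Real.log n ≤ d) (hs : 400 * d ≤ 3 * s)
    (hs' : n * Real.log n ≤ s * (d * Real.log d)) :
    (n.choose s : ℝ) * (n ^ s * (201 ^ (d ^ 2) * Real.exp (-(3 / 5 * (s * d))))) ≤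
      Real.exp (-(3 * d)) := by
  have hd0 : (0 : ℝ) < d := by exact_mod_cast hd1
  have hn0 : (0 : ℝ) < n := by exact_mod_cast (by omega : 0 < n)
  have hs0 : (0 : ℝ) < s := by exact_mod_cast (by omega : 0 < s)
  have hsr : (400 * d : ℝ) ≤ 3 * s := by exact_mod_cast hs
  have hd1' : (1 : ℝ) ≤ d := by exact_mod_cast hd1
  have hlogn : 1 ≤ Real.log n := by
    rw [Real.le_log_iff_exp_le hn0]
    have h3 : (3 : ℝ) ≤ n := by exact_mod_cast hn
    linarith [Real.exp_one_lt_d9]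
  have hlogd : Real.log d ≤ d := (Real.log_le_sub_one_of_pos hd0).trans (by linarith)
  have hns : (n : ℝ) ≤ s * d ^ 2 := by
    have h1 : (n : ℝ) ≤ n * Real.log n := le_mul_of_one_le_right hn0.le hlogn
    have h2 : s * (d * Real.log d) ≤ s * (d * d) := by gcongr
    nlinarith
  have hch : (n.choose s : ℝ) ≤ Real.exp (s * (1 + 2 * Real.log d)) := by
    calc (n.choose s : ℝ) ≤ n ^ s / s.factorial := Nat.choose_le_pow_div s n
      _ ≤ (s * d ^ 2) ^ s / s.factorial := by gcongr
      _ = s ^ s / s.factorial * (d ^ 2) ^ s := by ring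
      _ ≤ Real.exp s * (d ^ 2) ^ s := by
        gcongr
        exact Real.pow_div_factorial_le_exp _ hs0.le s
      _ = Real.exp (s * (1 + 2 * Real.log d)) := by
        rw [mul_add, Real.exp_add, mul_one, pow_eq_exp_mul_log (by positivity), Real.log_pow]
        norm_num
  have hpow : ((n : ℝ) ^ s) = Real.exp (s * Real.log n) := by
    exact pow_eq_exp_mul_log hn0 s
  have hnet : ((201 : ℝ) ^ (d ^ 2)) ≤ Real.exp (d ^ 2 * (8 * Real.log 2)) := by
    have h1 : ((201 : ℝ) ^ (d ^ 2)) ≤ (2 ^ 8) ^ (d ^ 2) := by gcongr; norm_num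
    refine h1.trans (le_of_eq ?_)
    rw [pow_eq_exp_mul_log (by norm_num), Real.log_pow]
    norm_num
  calc _ ≤ Real.exp (s * (1 + 2 * Real.log d)) * (Real.exp (s * Real.log n) *
        (Real.exp (d ^ 2 * (8 * Real.log 2)) * Real.exp (-(3 / 5 * (s * d))))) := by
        rw [hpow]
        gcongr
    _ ≤ Real.exp (-(3 * d)) := by
      rw [← Real.exp_add, ← Real.exp_add, ← Real.exp_add, Real.exp_le_exp]
      have hlog2 := Real.log_two_lt_d9
      have e1 : s * (1 + 2 * Real.log d) ≤ s * (d / 40) := by gcongr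
      have e2 : s * Real.log n ≤ s * (d / 2) := by
        gcongr
        linarith
      have e3 : d ^ 2 * (8 * Real.log 2) ≤ (3 / 400 * s * d) * (8 * 0.6931471808 : ℝ) := by
        have : (d : ℝ) ^ 2 ≤ 3 / 400 * s * d := by nlinarith
        have : (0 : ℝ) ≤ 3 / 400 * s * d := by positivity
        gcongr
      have e4 : 100 * (d : ℝ) ≤ s * d := by nlinarith
      nlinarith

/-- With high probability, for every large enough set `S` of indices, every injection `f` of `S`
into its complement and every orthogonal `Q`, the vectors `w i` and `Q w (f i)`, `i ∈ S`, are far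
apart on average. -/
lemma measureReal_exists_sum_sub_mulVec_le {d n : ℕ} (hd1 : 1 ≤ d) (hn : 3 ≤ n)
    (hd : 1 + 2 * Real.log d ≤ d / 40) (hdn : 2 * Real.log n ≤ d) :
    (gaussianCols d n).real {w | (∀ j, w j ⬝ᵥ w j ≤ 16 * d) ∧ ∃ (S : Finset (Fin n))
      (f : S → Fin n) (Q : Matrix.orthogonalGroup (Fin d) ℝ), Function.Injective f ∧
      (∀ i, f i ∉ S) ∧ 400 * d ≤ 3 * S.card ∧ n * Real.log n ≤ S.card * (d * Real.log d) ∧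
      ∑ i : S, (w i - (Q : Matrix (Fin d) (Fin d) ℝ) *ᵥ w (f i)) ⬝ᵥ
        (w i - (Q : Matrix (Fin d) (Fin d) ℝ) *ᵥ w (f i)) ≤ 21 / 100 * (S.card * d)} ≤
      (n + 1) * Real.exp (-(3 * d)) := by
  classical
  obtain ⟨N, hNc, hN⟩ := exists_finset_net_orthogonalGroup d (ε := 1 / 100) (by norm_num)
  have hNc' : (N.card : ℝ) ≤ 201 ^ (d ^ 2) := hNc.trans (le_of_eq (by norm_num))
  let valid : ℕ → Prop := fun s => 400 * d ≤ 3 * s ∧ n * Real.log n ≤ s * (d * Real.log d)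
  -- Including the conditions on `f` in the event lets the union run over all maps `S → Fin n`.
  let B : (S : Finset (Fin n)) → (S → Fin n) → Matrix.orthogonalGroup (Fin d) ℝ →
      Set (Fin n → Fin d → ℝ) := fun S f Q =>
    {w | Function.Injective f ∧ (∀ i, f i ∉ S) ∧
      ∑ i : S, (w i - (Q : Matrix (Fin d) (Fin d) ℝ) *ᵥ w (f i)) ⬝ᵥ
        (w i - (Q : Matrix (Fin d) (Fin d) ℝ) *ᵥ w (f i)) ≤ S.card * d / 4}
  have hB : ∀ S f Q, (gaussianCols d n).real (B S f Q) ≤ Real.exp (-(3 / 5 * (S.card * d))) := by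
    intro S f Q
    by_cases h : Function.Injective f ∧ ∀ i, f i ∉ S
    · refine (measureReal_mono ?_).trans (measureReal_sum_sub_mulVec_le S f h.1 h.2 Q)
      exact fun w hw => hw.2.2
    · have : B S f Q = ∅ := by
        ext w
        simp only [B, Set.mem_ofPred_eq, Set.mem_empty_iff_false, iff_false]
        exact fun hw => h ⟨hw.1, hw.2.1⟩
      rw [this, measureReal_empty]
      positivity
  refine (measureReal_mono (s₂ := ⋃ S ∈ Finset.univ.filter fun S : Finset (Fin n) => valid S.card,
    ⋃ f : S → Fin n, ⋃ Q ∈ N, B S f Q) ?_ (measure_ne_top _ _)).trans ?_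
  · rintro w ⟨hw, S, f, Q, hf, hfS, hv1, hv2, hle⟩
    obtain ⟨Q', hQ', hnear⟩ := hN Q
    simp only [Set.mem_iUnion]
    exact ⟨S, by simpa using ⟨hv1, hv2⟩, f, Q', hQ', hf, hfS,
      sum_sub_mulVec_le_of_near hw f hnear hle⟩
  · refine (measureReal_biUnion_finset_le _ _).trans ?_
    have h1 : ∀ S : Finset (Fin n), (gaussianCols d n).real (⋃ f : S → Fin n, ⋃ Q ∈ N, B S f Q) ≤
        n ^ S.card * (201 ^ (d ^ 2) * Real.exp (-(3 / 5 * (S.card * d)))) := by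
      intro S
      refine (measureReal_iUnion_fintype_le _).trans ?_
      have h2 : ∀ f : S → Fin n, (gaussianCols d n).real (⋃ Q ∈ N, B S f Q) ≤
          201 ^ (d ^ 2) * Real.exp (-(3 / 5 * (S.card * d))) := by
        intro f
        refine (measureReal_biUnion_finset_le _ _).trans ?_
        refine (Finset.sum_le_card_nsmul _ _ _ fun Q _ => hB S f Q).trans ?_
        rw [nsmul_eq_mul]
        gcongr
      refine (Finset.sum_le_card_nsmul _ _ _ fun f _ => h2 f).trans (le_of_eq ?_)
      rw [nsmul_eq_mul]
      simp
    refine (Finset.sum_le_sum fun S _ => h1 S).trans ?_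
    rw [Finset.sum_filter, ← Finset.powerset_univ, Finset.sum_powerset_apply_card (fun s =>
      if valid s then (n : ℝ) ^ s * (201 ^ (d ^ 2) * Real.exp (-(3 / 5 * (s * d)))) else 0)]
    rw [Finset.card_univ, Fintype.card_fin]
    refine (Finset.sum_le_card_nsmul _ _ (Real.exp (-(3 * d))) fun s _ => ?_).trans (le_of_eq ?_)
    · rw [nsmul_eq_mul]
      split_ifs with hv
      · exact choose_mul_pow_mul_exp_le hd1 hn hd hdn hv.1 hv.2
      · rw [mul_zero]
        positivity
    · rw [nsmul_eq_mul, Finset.card_range]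
      push_cast
      rfl

/-! ### Consequences of minimality -/

section FrobeniusNorm

attribute [local instance] Matrix.frobeniusNormedAddCommGroup

lemma frobenius_norm_sq {m k : ℕ} (M : Matrix (Fin m) (Fin k) ℝ) :
    ‖M‖ ^ 2 = ∑ j, M.col j ⬝ᵥ M.col j := by
  rw [Matrix.frobenius_norm_def, ← Real.sqrt_eq_rpow, Real.sq_sqrt (by positivity),
    Finset.sum_comm]
  simp [dotProduct, sq]

lemma ell2_eq_sum {d : ℕ} (Q Q' : Matrix.orthogonalGroup (Fin d) ℝ) :
    ell2 Q Q' = ∑ j, ((Q : Matrix (Fin d) (Fin d) ℝ) - (Q' : Matrix (Fin d) (Fin d) ℝ)).col j ⬝ᵥ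
      ((Q : Matrix (Fin d) (Fin d) ℝ) - (Q' : Matrix (Fin d) (Fin d) ℝ)).col j :=
  frobenius_norm_sq _

lemma loss_eq_sum {d n : ℕ} (X Y : Matrix (Fin d) (Fin n) ℝ) (π : Equiv.Perm (Fin n))
    (Q : Matrix.orthogonalGroup (Fin d) ℝ) :
    loss X Y π Q = (1 / (n : ℝ)) * ∑ j,
      ((Q : Matrix (Fin d) (Fin d) ℝ) *ᵥ X.col (π j) - Y.col j) ⬝ᵥ
        ((Q : Matrix (Fin d) (Fin d) ℝ) *ᵥ X.col (π j) - Y.col j) := by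
  have hQ : (Q : Matrix (Fin d) (Fin d) ℝ) * (Q : Matrix (Fin d) (Fin d) ℝ)ᵀ = 1 :=
    (Matrix.mem_orthogonalGroup_iff (Fin d) ℝ).1 Q.2
  unfold loss
  rw [frobenius_norm_sq]
  congr 1
  refine Finset.sum_congr rfl fun j _ => ?_
  have h1 : (X * (permMat π)ᵀ - (Q : Matrix (Fin d) (Fin d) ℝ)ᵀ * Y).col j =
      X.col (π j) - (Q : Matrix (Fin d) (Fin d) ℝ)ᵀ *ᵥ Y.col j := by
    ext a
    simp [Matrix.mul_apply, Matrix.mulVec, dotProduct, permMat, Equiv.Perm.permMatrix,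
      PEquiv.toMatrix_apply, Equiv.symm_apply_eq]
  rw [h1, ← dotProduct_mulVec_orthogonal Q, Matrix.mulVec_sub, Matrix.mulVec_mulVec, hQ,
    Matrix.one_mulVec]

end FrobeniusNorm

lemma observation_col {d n : ℕ} (σ : ℝ) (πs : Equiv.Perm (Fin n))
    (Qs : Matrix.orthogonalGroup (Fin d) ℝ) (X Z : Matrix (Fin d) (Fin n) ℝ) (j : Fin n) :
    (observation σ πs Qs X Z).col j =
      (Qs : Matrix (Fin d) (Fin d) ℝ) *ᵥ X.col (πs j) + σ • Z.col j := by
  ext a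
  simp [observation, Matrix.mul_apply, Matrix.mulVec, dotProduct, permMat, Equiv.Perm.permMatrix,
    PEquiv.toMatrix_apply, Equiv.symm_apply_eq]

lemma ell2_symm {d : ℕ} (Q Q' : Matrix.orthogonalGroup (Fin d) ℝ) : ell2 Q Q' = ell2 Q' Q := by
  rw [ell2_eq_sum, ell2_eq_sum]
  simp only [dotProduct, Matrix.col_apply, Matrix.sub_apply]
  exact Finset.sum_congr rfl fun j _ => Finset.sum_congr rfl fun a _ => by ring

/-- Squared Frobenius distances are invariant under left multiplication by an orthogonal matrix. -/
lemma ell2_eq_sum_one_sub {d : ℕ} (Q Q' : Matrix.orthogonalGroup (Fin d) ℝ) :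
    ell2 Q Q' = ∑ a, ((1 : Matrix (Fin d) (Fin d) ℝ) -
      ((Q⁻¹ * Q' : Matrix.orthogonalGroup (Fin d) ℝ) : Matrix (Fin d) (Fin d) ℝ)) a ⬝ᵥ
      ((1 : Matrix (Fin d) (Fin d) ℝ) -
      ((Q⁻¹ * Q' : Matrix.orthogonalGroup (Fin d) ℝ) : Matrix (Fin d) (Fin d) ℝ)) a := by
  have h : ∀ j, ((Q : Matrix (Fin d) (Fin d) ℝ) - (Q' : Matrix (Fin d) (Fin d) ℝ)).col j =
      (Q : Matrix (Fin d) (Fin d) ℝ) *ᵥ ((1 : Matrix (Fin d) (Fin d) ℝ) -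
      ((Q⁻¹ * Q' : Matrix.orthogonalGroup (Fin d) ℝ) : Matrix (Fin d) (Fin d) ℝ)).col j := by
    intro j
    have h1 : (Q : Matrix (Fin d) (Fin d) ℝ) *
        ((Q⁻¹ * Q' : Matrix.orthogonalGroup (Fin d) ℝ) : Matrix (Fin d) (Fin d) ℝ) = Q' := by
      rw [← Submonoid.coe_mul, mul_inv_cancel_left]
    have h2 : (Q : Matrix (Fin d) (Fin d) ℝ) - (Q' : Matrix (Fin d) (Fin d) ℝ) =
        (Q : Matrix (Fin d) (Fin d) ℝ) * (1 -
        ((Q⁻¹ * Q' : Matrix.orthogonalGroup (Fin d) ℝ) : Matrix (Fin d) (Fin d) ℝ)) := by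
      rw [mul_sub, mul_one, h1]
    rw [h2]
    ext a
    simp [Matrix.mul_apply, Matrix.mulVec, dotProduct]
  rw [ell2_eq_sum]
  simp_rw [h, dotProduct_mulVec_orthogonal]
  simp only [dotProduct, Matrix.col_apply]
  exact Finset.sum_comm

lemma ell2_le {d : ℕ} (Q Q' : Matrix.orthogonalGroup (Fin d) ℝ) : ell2 Q Q' ≤ 4 * d := by
  have h1 : ∀ (q : Matrix.orthogonalGroup (Fin d) ℝ) (j : Fin d),
      (q : Matrix (Fin d) (Fin d) ℝ).col j ⬝ᵥ (q : Matrix (Fin d) (Fin d) ℝ).col j = 1 := by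
    intro q j
    have h := congrFun (congrFun ((Matrix.mem_orthogonalGroup_iff' (Fin d) ℝ).1 q.2) j) j
    simpa [Matrix.mul_apply, dotProduct] using h
  have h2 : ∀ a b : Fin d → ℝ, (a - b) ⬝ᵥ (a - b) ≤ 2 * (a ⬝ᵥ a) + 2 * (b ⬝ᵥ b) := by
    intro a b
    simp only [dotProduct, Finset.mul_sum, ← Finset.sum_add_distrib, Pi.sub_apply]
    exact Finset.sum_le_sum fun k _ => by nlinarith [sq_nonneg (a k + b k)]
  rw [ell2_eq_sum]
  refine (Finset.sum_le_card_nsmul _ _ 4 fun j _ => ?_).trans (by simp [mul_comm])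
  refine (h2 ((Q : Matrix (Fin d) (Fin d) ℝ).col j) ((Q' : Matrix (Fin d) (Fin d) ℝ).col j)).trans
    (le_of_eq ?_)
  rw [h1, h1]
  norm_num

/-- The basic inequality: a minimizer fits the data at least as well as the truth, so by the
triangle inequality the two noiseless observations are at most twice the noise apart. It is stated
after removing `Qs` and `πs` by invariance. -/
lemma IsMLE.sum_sub_mulVec_le {d n : ℕ} {σ : ℝ} {πs : Equiv.Perm (Fin n)}
    {Qs : Matrix.orthogonalGroup (Fin d) ℝ} {X Z : Matrix (Fin d) (Fin n) ℝ}
    {π : Equiv.Perm (Fin n)} {Q : Matrix.orthogonalGroup (Fin d) ℝ}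
    (h : IsMLE X (observation σ πs Qs X Z) π Q) :
    ∑ i, (X.col i - ((Qs⁻¹ * Q : Matrix.orthogonalGroup (Fin d) ℝ) : Matrix (Fin d) (Fin d) ℝ) *ᵥ
        X.col (π (πs.symm i))) ⬝ᵥ
      (X.col i - ((Qs⁻¹ * Q : Matrix.orthogonalGroup (Fin d) ℝ) : Matrix (Fin d) (Fin d) ℝ) *ᵥ
        X.col (π (πs.symm i))) ≤ 4 * σ ^ 2 * ∑ j, Z.col j ⬝ᵥ Z.col j := by
  rcases Nat.eq_zero_or_pos n with rfl | hn
  · simp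
  have hn' : (0 : ℝ) < 1 / n := by positivity
  have h1 := h πs Qs
  rw [loss_eq_sum, loss_eq_sum, mul_le_mul_iff_right₀ hn'] at h1
  simp_rw [observation_col] at h1
  set b : Fin n → Fin d → ℝ := fun j => (Q : Matrix (Fin d) (Fin d) ℝ) *ᵥ X.col (π j) -
    (Qs : Matrix (Fin d) (Fin d) ℝ) *ᵥ X.col (πs j) with hb
  have h2 : ∀ j, (Q : Matrix (Fin d) (Fin d) ℝ) *ᵥ X.col (π j) -
      ((Qs : Matrix (Fin d) (Fin d) ℝ) *ᵥ X.col (πs j) + σ • Z.col j) = b j - σ • Z.col j :=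
    fun j => by rw [hb, sub_sub]
  simp_rw [h2, sub_add_cancel_left] at h1
  have h3 : ∑ j, b j ⬝ᵥ b j ≤ 2 * ∑ j, (b j - σ • Z.col j) ⬝ᵥ (b j - σ • Z.col j) +
      2 * ∑ j, (-(σ • Z.col j)) ⬝ᵥ (-(σ • Z.col j)) := by
    simp only [dotProduct, Finset.mul_sum, ← Finset.sum_add_distrib, Pi.sub_apply, Pi.neg_apply]
    refine Finset.sum_le_sum fun j _ => Finset.sum_le_sum fun a _ => ?_
    nlinarith [sq_nonneg (b j a - 2 * (σ • Z.col j) a)]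
  have h4 : ∑ j, (-(σ • Z.col j)) ⬝ᵥ (-(σ • Z.col j)) = σ ^ 2 * ∑ j, Z.col j ⬝ᵥ Z.col j := by
    rw [Finset.mul_sum]
    refine Finset.sum_congr rfl fun j _ => ?_
    rw [neg_dotProduct_neg, smul_dotProduct, dotProduct_smul, smul_eq_mul, smul_eq_mul]
    ring
  refine le_trans (le_of_eq ?_) (h3.trans (by linarith))
  rw [← Equiv.sum_comp πs]
  refine Finset.sum_congr rfl fun j _ => ?_
  rw [Equiv.symm_apply_apply, ← dotProduct_mulVec_orthogonal Qs, Matrix.mulVec_sub,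
    Matrix.mulVec_mulVec, ← Submonoid.coe_mul, mul_inv_cancel_left, hb, ← neg_dotProduct_neg,
    neg_sub]

/-- Every permutation moves a third of its support off itself: a maximal set `S` of moved points
with `ρ S` disjoint from `S` satisfies `supp ρ ⊆ S ∪ ρ S ∪ ρ⁻¹ S`. -/
lemma exists_disjoint_image_subset {ι : Type*} [Fintype ι] [DecidableEq ι] (ρ : Equiv.Perm ι) :
    ∃ S : Finset ι, (∀ i ∈ S, ρ i ∉ S) ∧
      (Finset.univ.filter fun i => ρ i ≠ i).card ≤ 3 * S.card := by
  obtain ⟨S, hS, hmax⟩ := Finset.exists_max_image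
    (Finset.univ.filter fun S : Finset ι => ∀ i ∈ S, ρ i ∉ S) Finset.card ⟨∅, by simp⟩
  simp only [Finset.mem_filter, Finset.mem_univ, true_and] at hS hmax
  refine ⟨S, hS, ?_⟩
  have hsub : (Finset.univ.filter fun i => ρ i ≠ i) ⊆ S ∪ (S.image ρ ∪ S.image ρ.symm) := by
    intro x hx
    simp only [Finset.mem_filter, Finset.mem_univ, true_and] at hx
    by_contra hcon
    simp only [Finset.mem_union, Finset.mem_image, not_or, not_exists, not_and] at hcon
    obtain ⟨h1, h2, h3⟩ := hcon
    have hρx : ρ x ∉ S := fun h => h3 _ h (ρ.symm_apply_apply x)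
    have := hmax (insert x S) (fun i hi => ?_)
    · rw [Finset.card_insert_of_notMem h1] at this
      omega
    · rw [Finset.mem_insert, not_or]
      rcases Finset.mem_insert.1 hi with rfl | hi
      · exact ⟨hx, hρx⟩
      · exact ⟨h2 i hi, hS i hi⟩
  calc _ ≤ _ := Finset.card_le_card hsub
    _ ≤ S.card + (S.card + S.card) := (Finset.card_union_le _ _).trans (add_le_add le_rfl
        ((Finset.card_union_le _ _).trans (add_le_add Finset.card_image_le Finset.card_image_le)))
    _ = 3 * S.card := by ring

/-- The part of the typical behaviour of `n` Gaussian vectors of `ℝ^d` on which the analysis of the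
maximum-likelihood estimators rests: norms of order `√d`, no orthogonal matching of a large subset
with vectors outside it, and well-conditioned Gram matrices for all large subfamilies. -/
structure IsTypical {d n : ℕ} (w : Fin n → Fin d → ℝ) : Prop where
  norm_le : ∀ j, w j ⬝ᵥ w j ≤ 16 * d
  separated : ∀ (S : Finset (Fin n)) (f : S → Fin n) (Q : Matrix.orthogonalGroup (Fin d) ℝ),
    Function.Injective f → (∀ i, f i ∉ S) → 400 * d ≤ 3 * S.card →
    n * Real.log n ≤ S.card * (d * Real.log d) →
    21 / 100 * (S.card * d) < ∑ i : S, (w i - (Q : Matrix (Fin d) (Fin d) ℝ) *ᵥ w (f i)) ⬝ᵥ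
        (w i - (Q : Matrix (Fin d) (Fin d) ℝ) *ᵥ w (f i))
  gram_ge : ∀ (F : Finset (Fin n)) (v : Fin d → ℝ), n ≤ 2 * F.card →
    n / 2 ^ 14 * (v ⬝ᵥ v) ≤ ∑ i ∈ F, (v ⬝ᵥ w i) ^ 2

lemma overlap_eq {n : ℕ} (hn : 0 < n) (πs π : Equiv.Perm (Fin n)) :
    overlap πs π =
      1 - ((Finset.univ.filter fun i => (πs.symm.trans π) i ≠ i).card : ℝ) / n := by
  have h1 : ∑ i : Fin n, (if πs i = π i then (1 : ℝ) else 0) =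
      ((Finset.univ.filter fun i => (πs.symm.trans π) i = i).card : ℝ) := by
    rw [← Equiv.sum_comp πs.symm]
    simp [eq_comm]
  have h2 := Finset.card_filter_add_card_filter_not (s := (Finset.univ : Finset (Fin n)))
    (fun i => (πs.symm.trans π) i = i)
  rw [Finset.card_univ, Fintype.card_fin] at h2
  have h3 : (n : ℝ) ≠ 0 := by positivity
  rw [overlap, h1, eq_sub_iff_add_eq]
  field_simp
  exact_mod_cast h2

section Typical

variable {d n : ℕ} {σ : ℝ} {πs : Equiv.Perm (Fin n)}
  {Qs : Matrix.orthogonalGroup (Fin d) ℝ} {X Z : Matrix (Fin d) (Fin n) ℝ}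
  {π : Equiv.Perm (Fin n)} {Q : Matrix.orthogonalGroup (Fin d) ℝ}

lemma IsTypical.le_overlap (hX : IsTypical X.col)
    (hZ : ∑ j, Z.col j ⬝ᵥ Z.col j ≤ 21 / 20 * (n * d)) (hn : 0 < n) (hd : 1 < d)
    (h : IsMLE X (observation σ πs Qs X Z) π Q) :
    1 - max (60 * σ ^ 2) (max (400 * (d / n : ℝ)) (3 * (Real.log n / (d * Real.log d)))) ≤
      overlap πs π := by
  rw [overlap_eq hn]
  set ρ := πs.symm.trans π with hρ
  set k := (Finset.univ.filter fun i => ρ i ≠ i).card with hk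
  by_contra! hcon
  have hlt := (sub_lt_sub_iff_left 1).1 hcon
  obtain ⟨h1, h2⟩ := max_lt_iff.1 hlt
  obtain ⟨h2, h3⟩ := max_lt_iff.1 h2
  have hn' : (0 : ℝ) < n := by exact_mod_cast hn
  have hd' : (1 : ℝ) < d := by exact_mod_cast hd
  have hdl : 0 < d * Real.log d := mul_pos (by linarith) (Real.log_pos hd')
  obtain ⟨S, hS, hSk⟩ := exists_disjoint_image_subset ρ
  rw [← hk] at hSk
  have hSk' : (k : ℝ) ≤ 3 * S.card := by exact_mod_cast hSk
  rw [lt_div_iff₀ hn'] at h1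
  have h2' : 400 * (d : ℝ) < k := by
    rw [mul_div_assoc', div_lt_div_iff_of_pos_right hn'] at h2
    exact h2
  have h3' : 3 * Real.log n * n < k * (d * Real.log d) := by
    rwa [mul_div_assoc', div_lt_div_iff₀ hdl hn'] at h3
  have hsep := hX.separated S (fun i => ρ i) (Qs⁻¹ * Q) (fun i j hij => by simpa using hij)
    (fun i => hS i i.2) (by exact_mod_cast (h2'.le.trans hSk')) (by nlinarith)
  have hsub : ∑ i : S, (X.col i - ((Qs⁻¹ * Q : Matrix.orthogonalGroup (Fin d) ℝ) :
        Matrix (Fin d) (Fin d) ℝ) *ᵥ X.col (ρ i)) ⬝ᵥ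
      (X.col i - ((Qs⁻¹ * Q : Matrix.orthogonalGroup (Fin d) ℝ) : Matrix (Fin d) (Fin d) ℝ) *ᵥ
        X.col (ρ i)) ≤ 4 * σ ^ 2 * ∑ j, Z.col j ⬝ᵥ Z.col j := by
    refine le_trans ?_ h.sum_sub_mulVec_le
    rw [Finset.sum_coe_sort S (fun i => (X.col i - ((Qs⁻¹ * Q : Matrix.orthogonalGroup (Fin d) ℝ) :
        Matrix (Fin d) (Fin d) ℝ) *ᵥ X.col (ρ i)) ⬝ᵥ
      (X.col i - ((Qs⁻¹ * Q : Matrix.orthogonalGroup (Fin d) ℝ) : Matrix (Fin d) (Fin d) ℝ) *ᵥ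
        X.col (ρ i)))]
    exact Finset.sum_le_sum_of_subset_of_nonneg (Finset.subset_univ _)
      fun i _ _ => dotProduct_self_nonneg_real _
  -- The constant `60` enters here: `4 * (21 / 20) * (3 / 60) = 21 / 100`.
  have h4 : 4 * σ ^ 2 * ∑ j, Z.col j ⬝ᵥ Z.col j ≤ 4 * σ ^ 2 * (21 / 20 * (n * d)) := by gcongr
  have h5 : 60 * σ ^ 2 * n * d ≤ 3 * S.card * d :=
    mul_le_mul_of_nonneg_right (h1.le.trans hSk') (by linarith)
  linarith

/-- Once half of the points are matched correctly, the orthogonal matrix is determined by linear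
regression on these points. -/
lemma IsTypical.ell2_le_of_overlap (hX : IsTypical X.col)
    (hZ : ∑ j, Z.col j ⬝ᵥ Z.col j ≤ 21 / 20 * (n * d)) (hn : 0 < n)
    (h : IsMLE X (observation σ πs Qs X Z) π Q) (hov : 1 / 2 ≤ overlap πs π) :
    ell2 Qs Q ≤ 2 ^ 17 * σ ^ 2 * d := by
  set ρ := πs.symm.trans π with hρ
  set F := Finset.univ.filter fun i => ρ i = i with hF
  have hn' : (0 : ℝ) < n := by exact_mod_cast hn
  have hFn : n ≤ 2 * F.card := by
    rw [overlap_eq hn] at hov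
    have h2 := Finset.card_filter_add_card_filter_not (s := (Finset.univ : Finset (Fin n)))
      (fun i => ρ i = i)
    rw [Finset.card_univ, Fintype.card_fin] at h2
    have h1 : 2 * (Finset.univ.filter fun i => ρ i ≠ i).card ≤ n := by
      have := (div_le_iff₀ hn').1 (by linarith :
        ((Finset.univ.filter fun i => ρ i ≠ i).card : ℝ) / n ≤ 1 / 2)
      have : (2 * (Finset.univ.filter fun i => ρ i ≠ i).card : ℝ) ≤ n := by linarith
      exact_mod_cast this
    simp only [ne_eq] at h1
    rw [← hF] at h2
    omega
  set O : Matrix (Fin d) (Fin d) ℝ :=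
    ((Qs⁻¹ * Q : Matrix.orthogonalGroup (Fin d) ℝ) : Matrix (Fin d) (Fin d) ℝ) with hO
  have h1 : n / 2 ^ 14 * ell2 Qs Q ≤ ∑ i ∈ F, (X.col i - O *ᵥ X.col (ρ i)) ⬝ᵥ
      (X.col i - O *ᵥ X.col (ρ i)) := by
    rw [ell2_eq_sum_one_sub, Finset.mul_sum]
    refine (Finset.sum_le_sum fun a _ => hX.gram_ge F _ hFn).trans (le_of_eq ?_)
    rw [Finset.sum_comm]
    refine Finset.sum_congr rfl fun i hi => ?_
    rw [(Finset.mem_filter.1 hi).2]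
    have h2 : X.col i - O *ᵥ X.col i = (1 - O) *ᵥ X.col i := by
      rw [Matrix.sub_mulVec, Matrix.one_mulVec]
    rw [h2, dotProduct]
    exact Finset.sum_congr rfl fun a _ => sq _
  have h2 : ∑ i ∈ F, (X.col i - O *ᵥ X.col (ρ i)) ⬝ᵥ (X.col i - O *ᵥ X.col (ρ i)) ≤
      4 * σ ^ 2 * ∑ j, Z.col j ⬝ᵥ Z.col j :=
    (Finset.sum_le_sum_of_subset_of_nonneg (Finset.subset_univ _)
      fun i _ _ => dotProduct_self_nonneg_real _).trans h.sum_sub_mulVec_le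
  have h3 : 4 * σ ^ 2 * ∑ j, Z.col j ⬝ᵥ Z.col j ≤ 4 * σ ^ 2 * (21 / 20 * (n * d)) := by gcongr
  have h4 : n * ell2 Qs Q ≤ n * (2 ^ 17 * σ ^ 2 * d) := by
    have : 0 ≤ n * (σ ^ 2 * d) := by positivity
    have h5 := (h1.trans h2).trans h3
    rw [div_mul_eq_mul_div, div_le_iff₀ (by norm_num)] at h5
    linarith
  exact le_of_mul_le_mul_left h4 hn'

lemma IsTypical.transportCost_le (hX : IsTypical X.col) (hn : 0 < n) (πs : Equiv.Perm (Fin n)) :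
    transportCost X π πs ≤ 64 * d * (1 - overlap πs π) := by
  have h1 : ∀ i, ‖WithLp.toLp 2 (X.col (π i)) - WithLp.toLp 2 (X.col (πs i))‖ ^ 2 ≤
      64 * d * (1 - if πs i = π i then 1 else 0) := by
    intro i
    split_ifs with hi
    · simp [hi]
    · rw [sub_zero, mul_one, EuclideanSpace.norm_sq_eq]
      have ha := hX.norm_le (π i)
      have hb := hX.norm_le (πs i)
      have : ∑ a, ‖(WithLp.toLp 2 (X.col (π i)) - WithLp.toLp 2 (X.col (πs i))).ofLp a‖ ^ 2 ≤
          2 * (X.col (π i) ⬝ᵥ X.col (π i)) + 2 * (X.col (πs i) ⬝ᵥ X.col (πs i)) := by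
        simp only [dotProduct, Finset.mul_sum, ← Finset.sum_add_distrib]
        refine Finset.sum_le_sum fun a _ => ?_
        rw [Real.norm_eq_abs, sq_abs, WithLp.ofLp_sub, Pi.sub_apply]
        nlinarith [sq_nonneg (X.col (π i) a + X.col (πs i) a)]
      linarith
  have hn' : (n : ℝ) ≠ 0 := by positivity
  refine (mul_le_mul_of_nonneg_left (Finset.sum_le_sum fun i _ => h1 i)
    (by positivity : (0 : ℝ) ≤ 1 / n)).trans (le_of_eq ?_)
  rw [← Finset.mul_sum, Finset.sum_sub_distrib, overlap]
  simp only [Finset.sum_const, Finset.card_univ, Fintype.card_fin, nsmul_eq_mul, mul_one]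
  field_simp

end Typical

/-! ### Typicality has high probability -/

/-- The columns of a Gaussian matrix are i.i.d. standard Gaussian vectors. Since the equivalence is
measurable in both directions, this gives the measure of all sets, measurable or not. -/
lemma exists_measurableEquiv_col (d n : ℕ) :
    ∃ e : Matrix (Fin d) (Fin n) ℝ ≃ᵐ (Fin n → Fin d → ℝ), (∀ X, e X = X.col) ∧
      MeasurePreserving e (gaussianMatrix d n) (gaussianCols d n) := by
  have hcurry : ∀ p q : ℕ, MeasurePreserving (MeasurableEquiv.curry (Fin p) (Fin q) ℝ)
      (Measure.pi fun _ => gaussianReal 0 1)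
      (Measure.pi fun _ => Measure.pi fun _ => gaussianReal 0 1) := fun p q => by
    refine ⟨MeasurableEquiv.measurable _, ?_⟩
    have h := Measure.infinitePi_map_curry (fun (_ : Fin p) (_ : Fin q) => gaussianReal 0 1)
    simpa only [Measure.infinitePi_eq_pi] using h
  have hswap := measurePreserving_piCongrLeft
    (fun _ : Fin n × Fin d => gaussianReal 0 1) (Equiv.prodComm (Fin d) (Fin n))
  refine ⟨(MeasurableEquiv.curry (Fin d) (Fin n) ℝ).symm.trans
    ((MeasurableEquiv.piCongrLeft (fun _ => ℝ) (Equiv.prodComm (Fin d) (Fin n))).trans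
      (MeasurableEquiv.curry (Fin n) (Fin d) ℝ)), fun X => rfl, ?_⟩
  exact ((hcurry n d).comp hswap).comp (hcurry d n).symm

lemma measureReal_not_isTypical_le {d n : ℕ} (hd1 : 1 ≤ d) (hn : 3 ≤ n)
    (hd : 1 + 2 * Real.log d ≤ d / 40) (hdn : 2 * Real.log n ≤ d) (hdn' : 400 * d ≤ n) :
    (gaussianCols d n).real {w | ¬ IsTypical w} ≤ 3 / n + 2 * Real.exp (-(n / 5)) := by
  have hn0 : (0 : ℝ) < n := by exact_mod_cast (by omega : 0 < n)
  have hexp : Real.exp (-(3 * d)) ≤ 1 / (n : ℝ) ^ 2 := by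
    have h1 : Real.exp (-(3 * d)) ≤ Real.exp (-(2 * Real.log n)) := by
      rw [Real.exp_le_exp]
      have : (0 : ℝ) ≤ d := by positivity
      linarith
    refine h1.trans (le_of_eq ?_)
    rw [Real.exp_neg, one_div, pow_eq_exp_mul_log hn0, Nat.cast_ofNat]
  have h1 := measureReal_exists_le_dotProduct_self d n
  have h2 := measureReal_exists_sum_sub_mulVec_le hd1 hn hd hdn
  have h3 := measureReal_exists_sum_dotProduct_sq_lt hdn'
  set A := {w : Fin n → Fin d → ℝ | ∃ j, (16 * d : ℝ) ≤ w j ⬝ᵥ w j}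
  set B := {w : Fin n → Fin d → ℝ | (∀ j, w j ⬝ᵥ w j ≤ 16 * d) ∧ ∃ (S : Finset (Fin n))
      (f : S → Fin n) (Q : Matrix.orthogonalGroup (Fin d) ℝ), Function.Injective f ∧
      (∀ i, f i ∉ S) ∧ 400 * d ≤ 3 * S.card ∧ n * Real.log n ≤ S.card * (d * Real.log d) ∧
      ∑ i : S, (w i - (Q : Matrix (Fin d) (Fin d) ℝ) *ᵥ w (f i)) ⬝ᵥ
        (w i - (Q : Matrix (Fin d) (Fin d) ℝ) *ᵥ w (f i)) ≤ 21 / 100 * (S.card * d)}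
  set C := {w : Fin n → Fin d → ℝ | ∃ (F : Finset (Fin n)) (v : Fin d → ℝ), n ≤ 2 * F.card ∧
      ∑ i ∈ F, (v ⬝ᵥ w i) ^ 2 < n / 2 ^ 14 * (v ⬝ᵥ v)}
  have hsub : {w : Fin n → Fin d → ℝ | ¬ IsTypical w} ⊆ (A ∪ B) ∪ C := by
    intro w hw
    by_contra hcon
    simp only [Set.mem_union, not_or] at hcon
    obtain ⟨⟨hA, hB⟩, hC⟩ := hcon
    have hnorm : ∀ j, w j ⬝ᵥ w j ≤ 16 * d := fun j => not_lt.1 fun hlt => hA ⟨j, hlt.le⟩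
    exact hw ⟨hnorm, fun S f Q hf hfS hv1 hv2 => not_le.1 fun hle =>
      hB ⟨hnorm, S, f, Q, hf, hfS, hv1, hv2, hle⟩,
      fun F v hF => not_lt.1 fun hlt => hC ⟨F, v, hF, hlt⟩⟩
  calc _ ≤ _ := measureReal_mono hsub
    _ ≤ (gaussianCols d n).real A + (gaussianCols d n).real B + (gaussianCols d n).real C :=
      (measureReal_union_le _ _).trans (add_le_add (measureReal_union_le _ _) le_rfl)
    _ ≤ (2 * n + 1) * Real.exp (-(3 * d)) + 2 * Real.exp (-(n / 5)) := by linarith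
    _ ≤ (2 * n + 1) * (1 / (n : ℝ) ^ 2) + 2 * Real.exp (-(n / 5)) := by gcongr
    _ ≤ _ := by
      have hn1 : (1 : ℝ) ≤ n := by exact_mod_cast (by omega : 1 ≤ n)
      gcongr
      rw [mul_one_div, div_le_div_iff₀ (by positivity) hn0]
      nlinarith

/-- The event, depending neither on `σ` nor on the planted `πs`, `Qs`, on which every
maximum-likelihood estimate is accurate. -/
def goodEvent (d n : ℕ) : Set (Matrix (Fin d) (Fin n) ℝ × Matrix (Fin d) (Fin n) ℝ) :=
  {ω | IsTypical ω.1.col ∧ ∑ j, ω.2.col j ⬝ᵥ ω.2.col j ≤ 21 / 20 * (n * d)}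

/-- An upper bound for the probability that `goodEvent d n` fails, uniform in `d`. -/
noncomputable def failureBound (n : ℕ) : ℝ≥0∞ :=
  ENNReal.ofReal (3 / n + 2 * Real.exp (-(n / 5)) + Real.exp (-(n / 10000)))

lemma tendsto_failureBound : Tendsto failureBound atTop (𝓝 0) := by
  have hexp : ∀ c : ℝ, 0 < c → Tendsto (fun n : ℕ => Real.exp (-((n : ℝ) / c))) atTop (𝓝 0) :=
    fun c hc => Real.tendsto_exp_neg_atTop_nhds_zero.comp
      (tendsto_natCast_atTop_atTop.atTop_div_const hc)
  have h := ((tendsto_const_div_atTop_nhds_zero_nat (3 : ℝ)).add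
    ((hexp 5 (by norm_num)).const_mul 2)).add (hexp 10000 (by norm_num))
  rw [← ENNReal.ofReal_zero, show (0 : ℝ) = 0 + 2 * 0 + 0 by norm_num]
  exact ENNReal.tendsto_ofReal h

lemma gaussianPair_compl_goodEvent_le {d n : ℕ} (hd1 : 1 ≤ d) (hn : 3 ≤ n)
    (hd : 1 + 2 * Real.log d ≤ d / 40) (hdn : 2 * Real.log n ≤ d) (hdn' : 400 * d ≤ n) :
    gaussianPair d n (goodEvent d n)ᶜ ≤ failureBound n := by
  obtain ⟨e, he, hmp⟩ := exists_measurableEquiv_col d n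
  have : IsProbabilityMeasure (gaussianMatrix d n) :=
    ⟨by rw [← Set.preimage_univ (f := e), hmp.measure_preimage_equiv, measure_univ]⟩
  set A : Set (Fin n → Fin d → ℝ) := {w | ¬ IsTypical w}
  set B : Set (Fin n → Fin d → ℝ) := {w | (21 / 20 * (n * d) : ℝ) ≤ ∑ j, w j ⬝ᵥ w j}
  have hsub : (goodEvent d n)ᶜ ⊆ ((e ⁻¹' A) ×ˢ Set.univ) ∪ (Set.univ ×ˢ (e ⁻¹' B)) := by
    intro ω hω
    by_contra hcon
    simp only [Set.mem_union, Set.mem_prod, Set.mem_univ, and_true, true_and, not_or,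
      Set.mem_preimage, he] at hcon
    exact hω ⟨not_not.1 hcon.1, (not_le.1 hcon.2).le⟩
  have hA : gaussianMatrix d n (e ⁻¹' A) ≤ ENNReal.ofReal (3 / n + 2 * Real.exp (-(n / 5))) := by
    rw [hmp.measure_preimage_equiv, ← ofReal_measureReal]
    exact ENNReal.ofReal_le_ofReal (measureReal_not_isTypical_le hd1 hn hd hdn hdn')
  have hB : gaussianMatrix d n (e ⁻¹' B) ≤ ENNReal.ofReal (Real.exp (-(n / 10000))) := by
    rw [hmp.measure_preimage_equiv, ← ofReal_measureReal]
    refine ENNReal.ofReal_le_ofReal (measureReal_le_sum_dotProduct_self.trans ?_)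
    rw [Real.exp_le_exp]
    have : (1 : ℝ) ≤ d := by exact_mod_cast hd1
    have : (n : ℝ) ≤ n * d := le_mul_of_one_le_right (by positivity) this
    linarith
  calc _ ≤ _ := measure_mono hsub
    _ ≤ _ := measure_union_le _ _
    _ = gaussianMatrix d n (e ⁻¹' A) + gaussianMatrix d n (e ⁻¹' B) := by
      rw [gaussianPair, Measure.prod_prod, Measure.prod_prod, measure_univ, mul_one, one_mul]
    _ ≤ _ := add_le_add hA hB
    _ = failureBound n := (ENNReal.ofReal_add (by positivity) (by positivity)).symm

lemma eventually_forall_le_log :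
    ∀ᶠ n : ℕ in atTop, 3 ≤ n ∧ ∀ d : ℕ, 2 * Real.log n ≤ d →
      1 < d ∧ 3 ≤ Real.log d ∧ 1 + 2 * Real.log d ≤ d / 40 := by
  have h1 : ∀ᶠ x : ℝ in atTop, 1 + 2 * Real.log x ≤ x / 40 := by
    have ho := Real.isLittleO_log_id_atTop.def (show (0 : ℝ) < 1 / 160 by norm_num)
    filter_upwards [ho, eventually_ge_atTop 80] with x hx hx80
    rw [Real.norm_eq_abs, Real.norm_eq_abs, id, abs_of_nonneg (by linarith : 0 ≤ x)] at hx
    linarith [le_abs_self (Real.log x)]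
  have h2 : ∀ᶠ x : ℝ in atTop, 3 ≤ Real.log x := Real.tendsto_log_atTop.eventually_ge_atTop 3
  obtain ⟨D, hD⟩ := eventually_atTop.1 (h1.and (h2.and (eventually_gt_atTop (1 : ℝ))))
  have h3 : Tendsto (fun n : ℕ => 2 * Real.log n) atTop atTop :=
    (Real.tendsto_log_atTop.comp tendsto_natCast_atTop_atTop).const_mul_atTop (by norm_num)
  filter_upwards [eventually_ge_atTop 3, h3.eventually_ge_atTop D] with n hn hnD
  refine ⟨hn, fun d hd => ?_⟩
  obtain ⟨ha, hb, hc⟩ := hD d (hnD.trans hd)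
  exact ⟨by exact_mod_cast hc, hb, ha⟩

/-! ### Accuracy of the estimators -/

lemma overlap_nonneg {n : ℕ} (π π' : Equiv.Perm (Fin n)) : 0 ≤ overlap π π' :=
  mul_nonneg (by positivity) (Finset.sum_nonneg fun i _ => by split_ifs <;> norm_num)

lemma mleFails_subset_compl_goodEvent {d n : ℕ} {σ : ℝ} {πs : Equiv.Perm (Fin n)}
    {Qs : Matrix.orthogonalGroup (Fin d) ℝ} {good : Matrix (Fin d) (Fin n) ℝ →
      Equiv.Perm (Fin n) → Matrix.orthogonalGroup (Fin d) ℝ → Prop}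
    (h : ∀ X Z π Q, (X, Z) ∈ goodEvent d n → IsMLE X (observation σ πs Qs X Z) π Q →
      good X π Q) :
    mleFails σ πs Qs good ⊆ (goodEvent d n)ᶜ := by
  rintro ⟨X, Z⟩ ⟨π, Q, hmle, hbad⟩ hgood
  exact hbad (h X Z π Q hgood hmle)

lemma exists_bounds_mle : ∃ c₁ c₂ c₃ : ℝ, 0 < c₁ ∧ 0 < c₂ ∧ 0 < c₃ ∧
    ∃ r : ℕ → ℝ≥0∞, Tendsto r atTop (𝓝 0) ∧
      ∀ (n d : ℕ) (σ : ℝ) (πs : Equiv.Perm (Fin n)) (Qs : Matrix.orthogonalGroup (Fin d) ℝ),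
        2 * Real.log n ≤ d → 0 < σ →
        gaussianPair d n (mleFails σ πs Qs fun _ π Q =>
          overlap πs π ≥ 1 - max (60 * σ ^ 2)
            (max (c₁ * (d / n)) (c₂ * (Real.log n / (d * Real.log d)))) ∧
          ell2 Qs Q / (2 * d) ≤ c₁ * (d / n) + c₂ * σ ^ 2 +
            c₃ * max (d * Real.log n / n) (Real.sqrt (Real.log n / n))) ≤ r n := by
  obtain ⟨n₀, hn₀⟩ := eventually_atTop.1 eventually_forall_le_log
  -- With these constants the claim on `Q` is trivial unless `400 d / n` and `60 σ ^ 2` are below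
  -- `1 / 2`; then the overlap is at least `1 / 2`, and regression on the matched points applies.
  refine ⟨1600, 2 ^ 18, 1, by norm_num, by norm_num, by norm_num,
    fun n => if n₀ ≤ n then failureBound n else ⊤, ?_, fun n d σ πs Qs hdn _ => ?_⟩
  · refine tendsto_failureBound.congr' ?_
    filter_upwards [eventually_ge_atTop n₀] with n hn
    rw [if_pos hn]
  beta_reduce
  split_ifs with hn
  swap
  · exact le_top
  obtain ⟨hn3, hall⟩ := hn₀ n hn
  obtain ⟨hd1, hlogd, hd⟩ := hall d hdn
  have hn' : (0 : ℝ) < n := by exact_mod_cast (by omega : 0 < n)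
  have hd' : (0 : ℝ) < d := by exact_mod_cast (by omega : 0 < d)
  have hlogn : 0 ≤ Real.log n := Real.log_natCast_nonneg n
  have hmax : 0 ≤ max (d * Real.log n / n) (√(Real.log n / n)) :=
    le_max_of_le_right (Real.sqrt_nonneg _)
  have hdn0 : (0 : ℝ) ≤ d / n := by positivity
  have hratio : 0 ≤ Real.log n / (d * Real.log d) := by positivity
  have htriv : ∀ Q, ell2 Qs Q / (2 * d) ≤ 2 := fun Q => by
    rw [div_le_iff₀ (by positivity)]
    linarith [ell2_le Qs Q]
  by_cases hdn' : 400 * d ≤ n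
  · refine le_trans (measure_mono (mleFails_subset_compl_goodEvent fun X Z π Q hg hmle => ?_))
      (gaussianPair_compl_goodEvent_le hd1.le hn3 hd hdn hdn')
    have hov := hg.1.le_overlap hg.2 (by omega) hd1 hmle
    refine ⟨le_trans (sub_le_sub_left (max_le_max le_rfl (max_le_max ?_ ?_)) 1) hov, ?_⟩
    · gcongr
      norm_num
    · gcongr
      norm_num
    · by_cases hbig : 2 ≤ 1600 * ((d : ℝ) / n) + 2 ^ 18 * σ ^ 2
      · linarith [htriv Q]
      · have hσ := sq_nonneg σ
        have h3 : 3 * (Real.log n / (d * Real.log d)) ≤ 1 / 2 := by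
          rw [mul_div_assoc', div_le_iff₀ (by positivity)]
          nlinarith
        have hhalf : 1 / 2 ≤ overlap πs π := by
          refine le_trans ?_ hov
          have : max (60 * σ ^ 2) (max (400 * (d / n : ℝ))
              (3 * (Real.log n / (d * Real.log d)))) ≤ 1 / 2 :=
            max_le (by linarith) (max_le (by linarith) h3)
          linarith
        have hell := hg.1.ell2_le_of_overlap hg.2 (by omega) hmle hhalf
        have : ell2 Qs Q / (2 * d) ≤ 2 ^ 16 * σ ^ 2 := by
          rw [div_le_iff₀ (by positivity)]
          linarith
        linarith
  · have hdn1 : 4 ≤ 1600 * ((d : ℝ) / n) := by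
      have : (n : ℝ) ≤ 400 * d := by exact_mod_cast (not_le.1 hdn').le
      rw [mul_div_assoc', le_div_iff₀ hn']
      linarith
    have hempty : ∀ good : Matrix (Fin d) (Fin n) ℝ → Equiv.Perm (Fin n) →
        Matrix.orthogonalGroup (Fin d) ℝ → Prop, (∀ X π Q, good X π Q) →
        gaussianPair d n (mleFails σ πs Qs good) ≤ failureBound n := by
      intro good hgood
      rw [show mleFails σ πs Qs good = ∅ from
        Set.eq_empty_of_forall_notMem fun ω ⟨π, Q, _, hbad⟩ => hbad (hgood _ π Q), measure_empty]
      exact zero_le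
    refine hempty _ fun X π Q => ⟨?_, ?_⟩
    · have h1 : 1600 * ((d : ℝ) / n) ≤ max (60 * σ ^ 2) (max (1600 * ((d : ℝ) / n))
          (2 ^ 18 * (Real.log n / (d * Real.log d)))) :=
        (le_max_left _ _).trans (le_max_right _ _)
      linarith [overlap_nonneg πs π]
    · have := sq_nonneg σ
      linarith [htriv Q]

lemma tendsto_gaussianPair_mleFails (d : ℕ → ℕ) (σ : ℕ → ℝ) (πs : ∀ n, Equiv.Perm (Fin n))
    (Qs : ∀ n, Matrix.orthogonalGroup (Fin (d n)) ℝ)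
    (hd : (fun n : ℕ => Real.log n) =o[atTop] (fun n : ℕ => (d n : ℝ)))
    (hdn : (fun n : ℕ => (d n : ℝ) * Real.log (d n)) =o[atTop] (fun n : ℕ => (n : ℝ)))
    (hσ : Tendsto σ atTop (𝓝 0)) {ε : ℝ} (hε : 0 < ε) :
    Tendsto (fun n : ℕ => gaussianPair (d n) n (mleFails (σ n) (πs n) (Qs n) fun X π Q =>
      overlap (πs n) π ≥ 1 - ε ∧ transportCost X π (πs n) ≤ ε * d n ∧
      ell2 Q (Qs n) ≤ ε * d n)) atTop (𝓝 0) := by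
  set δ : ℝ := min (ε / 64) (1 / 2) with hδ
  have hδ0 : 0 < δ := by positivity
  have hδε : 64 * δ ≤ ε := by linarith [min_le_left (ε / 64) (1 / 2)]
  have hδ2 : δ ≤ 1 / 2 := min_le_right _ _
  have hσ2 : Tendsto (fun n => σ n ^ 2) atTop (𝓝 0) := by simpa using hσ.pow 2
  refine tendsto_of_tendsto_of_tendsto_of_le_of_le' tendsto_const_nhds tendsto_failureBound
    (Eventually.of_forall fun n => zero_le) ?_
  filter_upwards [eventually_forall_le_log, hd.def (show (0 : ℝ) < 1 / 2 by norm_num),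
    hd.def (show 0 < δ / 3 by positivity), hdn.def (show 0 < δ / 400 by positivity),
    hσ2.eventually_le_const (show 0 < δ / 60 by positivity),
    hσ2.eventually_le_const (show 0 < ε / 2 ^ 17 by positivity)]
    with n hn hd2 hd3 hdn' hσδ hσε
  obtain ⟨hn3, hall⟩ := hn
  have hlogn : 0 ≤ Real.log n := Real.log_natCast_nonneg n
  have hn' : (0 : ℝ) < n := by exact_mod_cast (by omega : 0 < n)
  rw [Real.norm_of_nonneg hlogn, Real.norm_of_nonneg (Nat.cast_nonneg _)] at hd2 hd3
  have hlog2 : 2 * Real.log n ≤ d n := by linarith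
  obtain ⟨hd1, hlogd, hdlarge⟩ := hall (d n) hlog2
  have hd' : (0 : ℝ) < d n := by exact_mod_cast (by omega : 0 < d n)
  have hdl : 0 < d n * Real.log (d n) := by positivity
  rw [Real.norm_of_nonneg hdl.le, Real.norm_of_nonneg hn'.le] at hdn'
  have hdle : (d n : ℝ) ≤ d n * Real.log (d n) := le_mul_of_one_le_right hd'.le (by linarith)
  have h400 : 400 * d n ≤ n := by
    have : (400 * d n : ℝ) ≤ n := by nlinarith
    exact_mod_cast this
  refine le_trans (measure_mono (mleFails_subset_compl_goodEvent fun X Z π Q hg hmle => ?_))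
    (gaussianPair_compl_goodEvent_le hd1.le hn3 hdlarge hlog2 h400)
  have hov : 1 - δ ≤ overlap (πs n) π := by
    refine le_trans (sub_le_sub_left (max_le ?_ (max_le ?_ ?_)) 1)
      (hg.1.le_overlap hg.2 (by omega) hd1 hmle)
    · linarith
    · rw [mul_div_assoc', div_le_iff₀ hn']
      linarith
    · rw [mul_div_assoc', div_le_iff₀ hdl]
      have := mul_le_mul_of_nonneg_left hdle hδ0.le
      linarith
  refine ⟨by linarith, ?_, ?_⟩
  · refine (hg.1.transportCost_le (by omega) (πs n)).trans ?_
    have : 64 * (1 - overlap (πs n) π) ≤ ε := by linarith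
    have := mul_le_mul_of_nonneg_right this hd'.le
    linarith
  · rw [ell2_symm]
    refine (hg.1.ell2_le_of_overlap hg.2 (by omega) hmle (by linarith)).trans ?_
    refine mul_le_mul_of_nonneg_right ?_ hd'.le
    rw [le_div_iff₀ (by positivity)] at hσε
    linarith

end ProcrustesWasserstein

theorem theorem1 :
    (∃ c₁ c₂ c₃ : ℝ, 0 < c₁ ∧ 0 < c₂ ∧ 0 < c₃ ∧
      ∃ r : ℕ → ℝ≥0∞, Tendsto r atTop (𝓝 0) ∧
        ∀ (n d : ℕ) (σ : ℝ) (πs : Equiv.Perm (Fin n)) (Qs : Matrix.orthogonalGroup (Fin d) ℝ),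
          2 * Real.log n ≤ d → 0 < σ →
          ProcrustesWasserstein.gaussianPair d n
            (ProcrustesWasserstein.mleFails σ πs Qs fun _ π Q =>
              ProcrustesWasserstein.overlap πs π ≥
                  1 - max (60 * σ ^ 2)
                        (max (c₁ * (d / n)) (c₂ * (Real.log n / (d * Real.log d)))) ∧
              ProcrustesWasserstein.ell2 Qs Q / (2 * d) ≤
                  c₁ * (d / n) + c₂ * σ ^ 2 +
                    c₃ * max (d * Real.log n / n) (Real.sqrt (Real.log n / n))) ≤ r n) ∧
    (∀ (d : ℕ → ℕ) (σ : ℕ → ℝ) (πs : ∀ n, Equiv.Perm (Fin n))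
        (Qs : ∀ n, Matrix.orthogonalGroup (Fin (d n)) ℝ),
        (∀ n, 0 < σ n) →
        (fun n : ℕ => Real.log n) =o[atTop] (fun n : ℕ => (d n : ℝ)) →
        (fun n : ℕ => (d n : ℝ) * Real.log (d n)) =o[atTop] (fun n : ℕ => (n : ℝ)) →
        Tendsto σ atTop (𝓝 0) →
        ∀ ε : ℝ, 0 < ε →
          Tendsto (fun n : ℕ =>
            ProcrustesWasserstein.gaussianPair (d n) n
              (ProcrustesWasserstein.mleFails (σ n) (πs n) (Qs n) fun X π Q =>
                ProcrustesWasserstein.overlap (πs n) π ≥ 1 - ε ∧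
                ProcrustesWasserstein.transportCost X π (πs n) ≤ ε * d n ∧
                ProcrustesWasserstein.ell2 Q (Qs n) ≤ ε * d n)) atTop (𝓝 0)) :=
  ⟨ProcrustesWasserstein.exists_bounds_mle, fun d σ πs Qs _ hd hdn hσ _ hε =>
    ProcrustesWasserstein.tendsto_gaussianPair_mleFails d σ πs Qs hd hdn hσ hε⟩
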